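/- **Model.** Satellites, base stations (BSs) and terrestrial users lie on spheres centred at the origin of $\mathbb R^3$ with radii $R_{\sf s},R_{\sf b},R_{\sf u_t}$, and form homogeneous spherical Poisson point processes $\Phi_{\sf s},\Phi_{\sf b},\Phi_{\sf u_t}$ of densities $\lambda_{\sf s},\lambda_{\sf b},\lambda_{\sf u_t}>0$ (the number of points is Poisson with mean density times area; given the number, the points are i.i.d. uniform). The typical satellite user is at $\mathbf u=(0,0,R_{\sf u_s})$, where $0<R_{\sf u_s}<R_{\sf s}$, $R_{\sf u_s}<R_{\sf b}$, $R_{\sf u_t}=R_{\sf u_s}$. A satellite or BS is visible if its elevation angle seen from $\mathbf u$ is at least $\theta\in(-\pi/2,\pi/2)$; a terrestrial user is visible if its distance from $\mathbf u$ is at most $R_{\sf max}^{\sf u_t}$, where $0<R_{\sf max}^{\sf u_t}\le 2R_{\sf u_s}$. The power gains $H^{\sf s}$ of the satellite links are i.i.d., $\sqrt{H^{\sf s}}$ being Shadowed-Rician with density $$\Big(\tfrac{2bm_{\sf s}}{2bm_{\sf s}+\Omega}\Big)^{m_{\sf s}}\frac xb\,e^{-x^2/(2b)}\,{}_1F_1\Big(m_{\sf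 s};1;\tfrac{\Omega x^2}{2b(2bm_{\sf s}+\Omega)}\Big),\qquad x>0,$$ with $m_{\sf s}\ge1$ an integer, $b>0$, $\Omega\ge0$. The power gains $H^{\sf t}$ of the terrestrial links are i.i.d., $\sqrt{H^{\sf t}}$ being Nakagami with density $\frac{2m_{\sf t}^{m_{\sf t}}}{\Gamma(m_{\sf t})}x^{2m_{\sf t}-1}e^{-m_{\sf t}x^2}$, $x>0$, where $m_{\sf t}>0$. Point processes and gains are independent. Let $\alpha_{\sf s},\alpha_{\sf t}>0$ be the path-loss exponents, $\sigma^2>0$ the noise power, and $P_{\sf s},P_{\sf b},P_{\sf u_t}>0$ the transmit powers. With main- and side-lobe antenna gains $G^{\sf main}_{\cdot},G^{\sf side}_{\cdot}>0$, speed of light $c_0$ and carrier frequency $f_c$, put $\kappa=(c_0/(4\pi f_c))^2$ and $$G_1=G_{\sf u_s}^{\sf main}G_{\sf s}^{\sf main}\kappa,\quad G=G_{\sf u_s}^{\sf side}G_{\sf s}^{\sf side}\kappa,\quad G^{\sf b}=G_{\sf u_s}^{\sf side}G_{\sf b}^{\sf side}\kappa,\quad G^{\sf u_t}=G_{\sf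 u_s}^{\sf side}G_{\sf u_t}^{\sf side}\kappa.$$ The user is served by the nearest visible satellite $\mathbf x_1$. When the spectrum is shared with downlink ($o={\sf dn}$, interferers: visible BSs, $q={\sf b}$) or uplink ($o={\sf up}$, interferers: visible terrestrial users, $q={\sf u_t}$) terrestrial networks, $${\sf SINR}^o=\frac{G_1P_{\sf s}H_1^{\sf s}\|\mathbf x_1-\mathbf u\|^{-\alpha_{\sf s}}}{\sum_{n\ne1}GP_{\sf s}H_n^{\sf s}\|\mathbf x_n-\mathbf u\|^{-\alpha_{\sf s}}+\sum_{k}G^{q}P_{q}H_k^{\sf t}\|\mathbf y_k-\mathbf u\|^{-\alpha_{\sf t}}+\sigma^2},$$ the sums running over the other visible satellites $\mathbf x_n$ and over the visible terrestrial interferers $\mathbf y_k$; ${\sf SINR}^o=0$ if no satellite is visible. The ergodic spectral efficiency is $R_{\sf dn}^o=\mathbb E[\log_2(1+{\sf SINR}^o)]$. **Notation.** For $q\in\{{\sf s},{\sf b}\}$ let $\tilde\lambda_q=\lambda_qR_q/R_{\sf u_s}$, $R_{\sf min}^q=R_q-R_{\sf u_s}$, $R_{\sf max}^q=\sqrt{R_q^2-R_{\sf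 u_s}^2+R_{\sf u_s}^2\sin^2\theta}-R_{\sf u_s}\sin\theta$. Let $\beta=\frac1{2b}$, $c=\frac{\Omega}{2b(2bm_{\sf s}+\Omega)}$, $\zeta(z)=\big(\frac{2bm_{\sf s}}{2bm_{\sf s}+\Omega}\big)^{m_{\sf s}}\frac{\beta(-1)^z(1-m_{\sf s})_zc^z}{(z!)^2}$, where $(x)_z=x(x+1)\cdots(x+z-1)$. Let $$p_{\rm vis}=1-e^{-\tilde\lambda_{\sf s}\pi((R_{\sf max}^{\sf s})^2-(R_{\sf min}^{\sf s})^2)},\qquad f(r)=\frac{2\pi\tilde\lambda_{\sf s}e^{\tilde\lambda_{\sf s}\pi(R_{\sf min}^{\sf s})^2}}{p_{\rm vis}}\,r\,e^{-\tilde\lambda_{\sf s}\pi r^2},$$ $$\mathcal L_o(r,s)=\exp\Big(-s\sigma^2-2\pi\tilde\lambda_{\sf s}\int_r^{R_{\sf max}^{\sf s}}\Big[1-\sum_{z=0}^{m_{\sf s}-1}\frac{\zeta(z)\Gamma(z+1)}{(\beta-c+sGP_{\sf s}v^{-\alpha_{\sf s}})^{z+1}}\Big]v\,dv-T_o(s)\Big),$$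 $$T_{\sf dn}(s)=2\pi\tilde\lambda_{\sf b}\int_{R_{\sf min}^{\sf b}}^{R_{\sf max}^{\sf b}}\Big[1-\Big(1+\tfrac{sG^{\sf b}P_{\sf b}w^{-\alpha_{\sf t}}}{m_{\sf t}}\Big)^{-m_{\sf t}}\Big]w\,dw,$$ $$T_{\sf up}(s)=2\pi\lambda_{\sf u_t}\int_0^{R_{\sf max}^{\sf u_t}}\Big[1-\Big(1+\tfrac{sG^{\sf u_t}P_{\sf u_t}w^{-\alpha_{\sf t}}}{m_{\sf t}}\Big)^{-m_{\sf t}}\Big]w\,dw.$$ **Theorem 2.** For $o\in\{{\sf dn},{\sf up}\}$, the variable $\log_2(1+{\sf SINR}^o)$ is integrable, the iterated integral below converges absolutely (the inner one for every $\gamma>0$, then the outer one), and $$R_{\sf dn}^o=p_{\rm vis}\int_0^\infty\!\int_{R_{\sf min}^{\sf s}}^{R_{\sf max}^{\sf s}}\Bigg[1-\sum_{z=0}^{m_{\sf s}-1}\frac{\zeta(z)\Gamma(z+1)}{(\beta-c)^{z+1}}\Bigg(1-\sum_{v=0}^{z}\frac{((\beta-c)\gamma r^{\alpha_{\sf s}})^v}{(G_1P_{\sf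 s})^v\,v!}(-1)^v\frac{\partial^v\mathcal L_o(r,s)}{\partial s^v}\bigg|_{s=\frac{(\beta-c)\gamma r^{\alpha_{\sf s}}}{G_1P_{\sf s}}}\Bigg)\Bigg]f(r)\,\frac{\log_2e}{1+\gamma}\,dr\,d\gamma .$$ -/

import Mathlib

open MeasureTheory ProbabilityTheory Real Set

/-- Euclidean three-space. -/
abbrev Space3 : Type := EuclideanSpace ℝ (Fin 3)

/-- The surface area measure of the sphere of radius `R` centred at the origin, as a measure
on the ambient space: the image of the area measure of the unit sphere under `u ↦ R u`,
multiplied by `R ^ 2`. -/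
noncomputable def sphereArea (R : ℝ) : Measure Space3 :=
  ENNReal.ofReal (R ^ 2) •
    Measure.map (fun u : Metric.sphere (0 : Space3) 1 => R • (u : Space3))
      (volume : Measure Space3).toSphere

/-- The random points `x 0, …, x (N - 1)` form a homogeneous spherical Poisson point process of
density `lam` on the sphere of radius `R`: the number `N` of points is Poisson with mean
`lam` times the area of the sphere, and given `N = n` the `n` points are independent and
uniformly distributed on the sphere. (The variables `x i` with `i ≥ N` play no role.) -/
structure IsSphericalPoisson {Ω : Type*} [MeasurableSpace Ω] (P : Measure Ω) (R lam : ℝ)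
    (N : Ω → ℕ) (x : ℕ → Ω → Space3) : Prop where
  measurable_card : Measurable N
  measurable_point : ∀ i, Measurable (x i)
  law : ∀ (n : ℕ) (B : Fin n → Set Space3), (∀ i, MeasurableSet (B i)) →
    P {ω | N ω = n ∧ ∀ i : Fin n, x i ω ∈ B i} =
      poissonMeasure (lam * (sphereArea R).real univ).toNNReal {n} *
        ∏ i, (sphereArea R univ)⁻¹ * sphereArea R (B i)

/-- Confluent hypergeometric function of the first kind,
`₁F₁(a; b; x) = ∑ₖ (a)ₖ / (b)ₖ * xᵏ / k!`. -/
noncomputable def confluentHypergeometric (a b x : ℝ) : ℝ :=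
  ∑' k : ℕ, (ascPochhammer ℝ k).eval a / (ascPochhammer ℝ k).eval b * x ^ k / (k.factorial : ℝ)

/-- Density of the amplitude of a Shadowed-Rician channel coefficient: `2 b` is the average power
of the scatter component, `Om` that of the line-of-sight component, `m` the Nakagami
parameter. -/
noncomputable def shadowedRicianPDF (m b Om x : ℝ) : ℝ :=
  if 0 < x then
    (2 * b * m / (2 * b * m + Om)) ^ m * (x / b) * exp (-x ^ 2 / (2 * b)) *
      confluentHypergeometric m 1 (Om * x ^ 2 / (2 * b * (2 * b * m + Om)))
  else 0

/-- Density of the amplitude of a Nakagami-`m` channel coefficient of unit mean power. -/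
noncomputable def nakagamiPDF (m x : ℝ) : ℝ :=
  if 0 < x then 2 * m ^ m / Gamma m * x ^ (2 * m - 1) * exp (-m * x ^ 2) else 0

/-- `H 0, H 1, …` are independent random power gains whose amplitudes `√(H i)` all have the
density `p`. -/
structure IsFading {Ω : Type*} [MeasurableSpace Ω] (P : Measure Ω) (p : ℝ → ℝ)
    (H : ℕ → Ω → ℝ) : Prop where
  measurable : ∀ i, Measurable (H i)
  nonneg : ∀ i ω, 0 ≤ H i ω
  indep : iIndepFun H P
  law : ∀ i, HasLaw (fun ω => √(H i ω)) (volume.withDensity fun t => ENNReal.ofReal (p t)) P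

/-- The terrestrial network sharing the spectrum: downlink (interferers are base stations) or
uplink (interferers are terrestrial users). -/
inductive TerrestrialLink
  | dn
  | up

/-- Parameters of the downlink satellite network and the terrestrial networks. Suffixes: `S`
satellites, `U` satellite users, `B` base stations, `T` terrestrial users. -/
structure NetworkParams where
  /-- radii of the concentric spheres carrying the nodes -/
  (RS RU RB RT : ℝ)
  /-- densities of the spherical Poisson point processes -/
  (lamS lamB lamT : ℝ)
  /-- minimum elevation angle at which the typical satellite user sees a node -/
  theta : ℝ
  /-- radius of the visible disc of terrestrial users around the typical satellite user -/
  RmaxT : ℝ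
  /-- transmit powers -/
  (PS PB PT : ℝ)
  /-- main-lobe and side-lobe antenna gains -/
  (GSmain GSside GUmain GUside GBside GTside : ℝ)
  /-- speed of light and carrier frequency -/
  (lightSpeed fc : ℝ)
  /-- Nakagami parameter of the satellite channel -/
  mS : ℕ
  /-- scatter (`2 b`) and line-of-sight (`Om`) average powers of the satellite channel -/
  (b Om : ℝ)
  /-- Nakagami parameter of the terrestrial channel -/
  mT : ℝ
  /-- path-loss exponents of satellite and terrestrial links -/
  (alphaS alphaT : ℝ)
  /-- noise power `σ ^ 2` -/
  noise : ℝ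

namespace NetworkParams

/-- The standing assumptions on the parameters. -/
structure Valid (p : NetworkParams) : Prop where
  RU_pos : 0 < p.RU
  RU_lt_RS : p.RU < p.RS
  RU_lt_RB : p.RU < p.RB
  RT_eq_RU : p.RT = p.RU
  lamS_pos : 0 < p.lamS
  lamB_pos : 0 < p.lamB
  lamT_pos : 0 < p.lamT
  theta_gt : -(π / 2) < p.theta
  theta_lt : p.theta < π / 2
  RmaxT_pos : 0 < p.RmaxT
  RmaxT_le : p.RmaxT ≤ 2 * p.RU
  PS_pos : 0 < p.PS
  PB_pos : 0 < p.PB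
  PT_pos : 0 < p.PT
  GSmain_pos : 0 < p.GSmain
  GSside_pos : 0 < p.GSside
  GUmain_pos : 0 < p.GUmain
  GUside_pos : 0 < p.GUside
  GBside_pos : 0 < p.GBside
  GTside_pos : 0 < p.GTside
  lightSpeed_pos : 0 < p.lightSpeed
  fc_pos : 0 < p.fc
  mS_pos : 0 < p.mS
  b_pos : 0 < p.b
  Om_nonneg : 0 ≤ p.Om
  mT_pos : 0 < p.mT
  alphaS_pos : 0 < p.alphaS
  alphaT_pos : 0 < p.alphaT
  noise_pos : 0 < p.noise

variable (p : NetworkParams)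

/-! ### Geometry, gains and the random model -/

/-- Position `(0, 0, R_U)` of the typical satellite user. -/
noncomputable def user : Space3 := !₂[0, 0, p.RU]

/-- Visible spherical cap of the sphere of radius `R`: the points of elevation angle at least
`theta` above the horizontal plane of the typical satellite user. -/
def visibleCap (R : ℝ) : Set Space3 :=
  {x | ‖x‖ = R ∧ ‖x - p.user‖ * sin p.theta ≤ x 2 - p.RU}

/-- Visible region of terrestrial users: the disc of radius `RmaxT` around the typical satellite
user on the sphere of terrestrial users. -/
def visibleDisc : Set Space3 := {x | ‖x‖ = p.RT ∧ ‖x - p.user‖ ≤ p.RmaxT}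

/-- Free-space factor `(c / (4 π f_c)) ^ 2`. -/
noncomputable def freeSpace : ℝ := (p.lightSpeed / (4 * π * p.fc)) ^ 2

/-- Effective antenna gain from the serving satellite. -/
noncomputable def gainServing : ℝ := p.GUmain * p.GSmain * p.freeSpace

/-- Effective antenna gain from every other satellite. -/
noncomputable def gainSatellite : ℝ := p.GUside * p.GSside * p.freeSpace

/-- Effective antenna gain from the terrestrial interferers. -/
noncomputable def gainTerrestrial : TerrestrialLink → ℝ
  | .dn => p.GUside * p.GBside * p.freeSpace
  | .up => p.GUside * p.GTside * p.freeSpace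

/-- Transmit power of the terrestrial interferers. -/
def powerTerrestrial : TerrestrialLink → ℝ
  | .dn => p.PB
  | .up => p.PT

/-- Radius of the sphere carrying the terrestrial interferers. -/
def radiusTerrestrial : TerrestrialLink → ℝ
  | .dn => p.RB
  | .up => p.RT

/-- Density of the terrestrial interferers. -/
def densityTerrestrial : TerrestrialLink → ℝ
  | .dn => p.lamB
  | .up => p.lamT

/-- Visible region of the terrestrial interferers. -/
def visibleTerrestrial : TerrestrialLink → Set Space3
  | .dn => p.visibleCap p.RB
  | .up => p.visibleDisc

open Classical in
/-- Indices of the visible points among `x 0, …, x (n - 1)`. -/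
noncomputable def visibleIndices (A : Set Space3) (n : ℕ) (x : ℕ → Space3) : Finset ℕ :=
  (Finset.range n).filter fun i => x i ∈ A

/-- Index of the visible satellite nearest to the typical satellite user (the least such index in
case of a tie). -/
noncomputable def servingIndex (n : ℕ) (x : ℕ → Space3) : ℕ :=
  sInf {i | i ∈ visibleIndices (p.visibleCap p.RS) n x ∧
    ∀ j ∈ visibleIndices (p.visibleCap p.RS) n x, ‖x i - p.user‖ ≤ ‖x j - p.user‖}

open Classical in
/-- The signal-to-interference-plus-noise ratio at the typical satellite user, for satellites
`x 0, …, x (n - 1)` with power gains `h`, and terrestrial interferers `y 0, …, y (k - 1)` with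
power gains `g`. It is `0` if no satellite is visible. -/
noncomputable def sinr (o : TerrestrialLink) (n : ℕ) (x : ℕ → Space3) (h : ℕ → ℝ)
    (k : ℕ) (y : ℕ → Space3) (g : ℕ → ℝ) : ℝ :=
  if (visibleIndices (p.visibleCap p.RS) n x).Nonempty then
    p.gainServing * p.PS * h (p.servingIndex n x) *
        ‖x (p.servingIndex n x) - p.user‖ ^ (-p.alphaS) /
      ((∑ i ∈ (visibleIndices (p.visibleCap p.RS) n x).erase (p.servingIndex n x),
          p.gainSatellite * p.PS * h i * ‖x i - p.user‖ ^ (-p.alphaS)) +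
        (∑ i ∈ visibleIndices (p.visibleTerrestrial o) k y,
          p.gainTerrestrial o * p.powerTerrestrial o * g i * ‖y i - p.user‖ ^ (-p.alphaT)) +
        p.noise)
  else 0

/-! ### The closed-form expressions -/

/-- Least distance from the typical satellite user to the visible cap of radius `R`. -/
def Rmin (R : ℝ) : ℝ := R - p.RU

/-- Greatest distance from the typical satellite user to the visible cap of radius `R`. -/
noncomputable def Rmax (R : ℝ) : ℝ :=
  √(R ^ 2 - p.RU ^ 2 + p.RU ^ 2 * sin p.theta ^ 2) - p.RU * sin p.theta

/-- Planar density equivalent to the density `lam` on the sphere of radius `R`. -/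
noncomputable def planarDensity (lam R : ℝ) : ℝ := lam * (R / p.RU)

noncomputable def beta : ℝ := 1 / (2 * p.b)

noncomputable def c : ℝ := p.Om / (2 * p.b * (2 * p.b * p.mS + p.Om))

noncomputable def zeta (z : ℕ) : ℝ :=
  (2 * p.b * p.mS / (2 * p.b * p.mS + p.Om)) ^ p.mS *
    (p.beta * (-1) ^ z * (ascPochhammer ℝ z).eval (1 - (p.mS : ℝ)) * p.c ^ z) /
      (z.factorial : ℝ) ^ 2

/-- Exponent contributed by the satellites farther than `r`. -/
noncomputable def satelliteExponent (r s : ℝ) : ℝ :=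
  2 * π * p.planarDensity p.lamS p.RS * ∫ v in r..p.Rmax p.RS,
    (1 - ∑ z ∈ Finset.range p.mS, p.zeta z * Gamma (z + 1) /
      (p.beta - p.c + s * p.gainSatellite * p.PS * v ^ (-p.alphaS)) ^ (z + 1)) * v

/-- Exponent contributed by the terrestrial interferers. -/
noncomputable def terrestrialExponent : TerrestrialLink → ℝ → ℝ
  | .dn, s => 2 * π * p.planarDensity p.lamB p.RB * ∫ w in p.Rmin p.RB..p.Rmax p.RB,
      (1 - (1 + s * p.gainTerrestrial .dn * p.PB * w ^ (-p.alphaT) / p.mT) ^ (-p.mT)) * w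
  | .up, s => 2 * π * p.lamT * ∫ w in 0..p.RmaxT,
      (1 - (1 + s * p.gainTerrestrial .up * p.PT * w ^ (-p.alphaT) / p.mT) ^ (-p.mT)) * w

/-- Conditional Laplace transform, at `s`, of the aggregated interference plus noise power when the
serving satellite is at distance `r`. -/
noncomputable def laplaceInterference (o : TerrestrialLink) (r s : ℝ) : ℝ :=
  exp (-s * p.noise - p.satelliteExponent r s - p.terrestrialExponent o s)

/-- Probability that at least one satellite is visible. -/
noncomputable def visibleProb : ℝ :=
  1 - exp (-p.planarDensity p.lamS p.RS * π * (p.Rmax p.RS ^ 2 - p.Rmin p.RS ^ 2))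

/-- Density of the distance to the nearest satellite, given that some satellite is visible. -/
noncomputable def nearestPDF (r : ℝ) : ℝ :=
  2 * p.planarDensity p.lamS p.RS * π *
      exp (p.planarDensity p.lamS p.RS * π * p.Rmin p.RS ^ 2) / p.visibleProb *
    r * exp (-p.planarDensity p.lamS p.RS * π * r ^ 2)

/-- The conditional coverage probability at threshold `γ` and serving distance `r`. -/
noncomputable def coverage (o : TerrestrialLink) (γ r : ℝ) : ℝ :=
  1 - ∑ z ∈ Finset.range p.mS,
    p.zeta z * Gamma (z + 1) / (p.beta - p.c) ^ (z + 1) *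
      (1 - ∑ v ∈ Finset.range (z + 1),
        ((p.beta - p.c) * γ * r ^ p.alphaS) ^ v /
            ((p.gainServing * p.PS) ^ v * (v.factorial : ℝ)) *
          (-1) ^ v *
          iteratedDeriv v (p.laplaceInterference o r)
            ((p.beta - p.c) * γ * r ^ p.alphaS / (p.gainServing * p.PS)))

/-- Integrand of the spectral efficiency formula. -/
noncomputable def rateIntegrand (o : TerrestrialLink) (γ r : ℝ) : ℝ :=
  p.coverage o γ r * p.nearestPDF r * (logb 2 (exp 1) / (1 + γ))

end NetworkParams

/-!
The probability that the SINR exceeds `γ` is computed exactly, and the layer-cake formula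
`integral_logb_one_add` for `log₂ (1 + SINR)` then gives the spectral efficiency.

Marking every satellite with its gain gives a Poisson process of pairs (`IsPoissonWith`), which is
independent of the terrestrial interference `J`. Almost surely no two satellites are equally far
from the user, so that a function of the SINR is a sum over the satellites of terms that vanish
unless the satellite is visible and all other visible ones are farther away
(`comp_sinr_eq_servingSum`). The Mecke formula (`IsPoissonWith.mecke`) integrates over the serving
satellite and leaves an independent copy of the whole process as interferers, restricted to the
event `emptyEvent` that no visible satellite is within the serving distance `r`. By Archimedes'
hat-box theorem (`toSphere_cap`, `map_dist_sphereArea`), the distance of a point of a sphere to the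
user has a linear density, which produces `nearestPDF`.

For fixed `r`, let `X` be the interference plus noise. Kummer's transformation
(`confluentHypergeometric_natCast_one`) makes the satellite gain a mixture of Erlang laws, whose
complementary distribution function is a polynomial times an exponential
(`satelliteGainLaw_Ioi`). Integrating out the gain of the serving link therefore leaves a linear
combination of the means of `X ^ v * exp (-s * X)` on `emptyEvent`. The Laplace functional of the
Poisson processes (`lintegral_prod_sphere`) identifies the mean of `exp (-s * X)` with
`laplaceInterference`, up to the probability of `emptyEvent`, and its derivatives in `s` are the
required moments (`integral_pow_mul_exp_neg_totalInterference`). This is the formula `coverage`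
(`lintegral_meanAt_indicator`).

Integrability comes for free from working with integrals in `[0, ∞]`: the tail probabilities are
finite, and the SINR has finite mean because the noise bounds it by a multiple of the gain of the
serving link (`lintegral_servingSum_ofReal_lt_top`).
-/

/-! ### Archimedes' hat-box theorem -/

/-- A disc in the plane has area `π` times its squared radius, so the squared norm is distributed
like `π` times Lebesgue measure on the half-line. -/
theorem volume_map_norm_sq_plane :
    (volume : Measure (EuclideanSpace ℝ (Fin 2))).map (fun w => ‖w‖ ^ 2) =
      ENNReal.ofReal π • (volume : Measure ℝ).restrict (Ici 0) := by
  have hf : Measurable fun w : EuclideanSpace ℝ (Fin 2) => ‖w‖ ^ 2 := by fun_prop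
  have h1 : ∀ b, (volume : Measure (EuclideanSpace ℝ (Fin 2))).map (fun w => ‖w‖ ^ 2) (Iic b) =
      ENNReal.ofReal π * ENNReal.ofReal b := by
    intro b
    rw [Measure.map_apply hf measurableSet_Iic]
    rcases le_or_gt 0 b with hb | hb
    · have : (fun w : EuclideanSpace ℝ (Fin 2) => ‖w‖ ^ 2) ⁻¹' Iic b =
          Metric.closedBall 0 √b := by
        ext w; simp [Real.le_sqrt (norm_nonneg w) hb]
      rw [this, EuclideanSpace.volume_closedBall_fin_two, ← ENNReal.ofReal_pow (by positivity),
        Real.sq_sqrt hb, mul_comm]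
    · have : (fun w : EuclideanSpace ℝ (Fin 2) => ‖w‖ ^ 2) ⁻¹' Iic b = ∅ := by
        ext w; simp; nlinarith [sq_nonneg ‖w‖]
      rw [this, ENNReal.ofReal_of_nonpos hb.le]; simp
  have h2 : ∀ b, (ENNReal.ofReal π • (volume : Measure ℝ).restrict (Ici 0)) (Iic b) =
      ENNReal.ofReal π * ENNReal.ofReal b := by
    intro b
    rw [Measure.smul_apply, Measure.restrict_apply measurableSet_Iic, inter_comm, Ici_inter_Iic,
      Real.volume_Icc, sub_zero, smul_eq_mul]
  have hfin : IsLocallyFiniteMeasure (ENNReal.ofReal π • (volume : Measure ℝ).restrict (Ici 0)) :=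
    inferInstanceAs (IsLocallyFiniteMeasure (Real.toNNReal π • (volume : Measure ℝ).restrict (Ici 0)))
  refine (Measure.ext_of_Ioc _ _ fun a b hab => ?_).symm
  rw [← Iic_sdiff_Iic, measure_sdiff (Iic_subset_Iic.2 hab.le) measurableSet_Iic.nullMeasurableSet
    (by rw [h2]; finiteness), measure_sdiff (Iic_subset_Iic.2 hab.le)
    measurableSet_Iic.nullMeasurableSet (by rw [h1]; finiteness), h1, h1, h2, h2]

/-- In cylindrical coordinates, with the squared distance to the axis as radial variable,
Lebesgue measure on space is `π` times a product of Lebesgue measures. -/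
theorem measurePreserving_height_axis_sq :
    MeasurePreserving (fun x : Space3 => (x 2, x 0 ^ 2 + x 1 ^ 2)) volume
      ((volume : Measure ℝ).prod (ENNReal.ofReal π • (volume : Measure ℝ).restrict (Ici 0))) := by
  have h1 := PiLp.volume_preserving_ofLp (Fin 3)
  have h2 := volume_preserving_piFinSuccAbove (fun _ : Fin 3 => ℝ) 2
  have h3 := PiLp.volume_preserving_toLp (Fin 2)
  have h4 : MeasurePreserving (fun w : EuclideanSpace ℝ (Fin 2) => ‖w‖ ^ 2) volume
      (ENNReal.ofReal π • (volume : Measure ℝ).restrict (Ici 0)) :=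
    ⟨by fun_prop, volume_map_norm_sq_plane⟩
  have h5 := ((MeasurePreserving.id (volume : Measure ℝ)).prod (h4.comp h3)).comp (h2.comp h1)
  convert! h5 using 1
  funext x
  simp only [Function.comp_apply, EuclideanSpace.norm_sq_eq, Fin.sum_univ_two,
    Real.norm_eq_abs, sq_abs]
  rfl

theorem norm_sq_space3 (x : Space3) : ‖x‖ ^ 2 = x 0 ^ 2 + x 1 ^ 2 + x 2 ^ 2 := by
  simp [EuclideanSpace.norm_sq_eq, Fin.sum_univ_three]

/-- The volume of the solid spherical sector over a spherical cap. -/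
theorem volume_sector {t : ℝ} (h1 : -1 ≤ t) (h2 : t ≤ 1) :
    (volume : Measure Space3) {x | 0 < ‖x‖ ∧ ‖x‖ < 1 ∧ t * ‖x‖ ≤ x 2} =
      ENNReal.ofReal (2 * π / 3 * (1 - t)) := by
  set T : Set (ℝ × ℝ) := {y | 0 < y.2 ∧ y.2 < 1 ∧ t * √y.2 ≤ y.1} with hT
  have hTm : MeasurableSet T := by
    have ha : MeasurableSet {y : ℝ × ℝ | 0 < y.2} := measurableSet_lt (by fun_prop) (by fun_prop)
    have hb : MeasurableSet {y : ℝ × ℝ | y.2 < 1} := measurableSet_lt (by fun_prop) (by fun_prop)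
    have hc : MeasurableSet {y : ℝ × ℝ | t * √y.2 ≤ y.1} :=
      measurableSet_le (by fun_prop) (by fun_prop)
    exact ha.inter (hb.inter hc)
  have hTm' : MeasurableSet (T ∩ {y | y.1 ^ 2 ≤ y.2}) :=
    hTm.inter (measurableSet_le (by fun_prop) (by fun_prop))
  have e1 : {x : Space3 | 0 < ‖x‖ ∧ ‖x‖ < 1 ∧ t * ‖x‖ ≤ x 2} =
      (fun x : Space3 => (x 2, x 0 ^ 2 + x 1 ^ 2)) ⁻¹'
        ((fun y : ℝ × ℝ => (y.1, y.2 + y.1 ^ 2)) ⁻¹' T) := by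
    ext x
    have hx := norm_sq_space3 x
    have hx' : ‖x‖ = √(x 0 ^ 2 + x 1 ^ 2 + x 2 ^ 2) := by rw [← hx, Real.sqrt_sq (norm_nonneg _)]
    simp only [hT, mem_ofPred_eq, mem_preimage]
    rw [← hx', ← hx, sq_pos_iff, sq_lt_one_iff₀ (norm_nonneg _)]
    simp
  have hsm : Measurable fun y : ℝ × ℝ => (y.1, y.2 + y.1 ^ 2) := by fun_prop
  rw [e1, measurePreserving_height_axis_sq.measure_preimage (hsm hTm).nullMeasurableSet,
    Measure.prod_apply (hsm hTm)]
  -- for fixed height `z`, the squared axis distance `q` is replaced by `s = q + z ^ 2 = ‖x‖ ^ 2`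
  have e2 : ∀ z : ℝ, (ENNReal.ofReal π • (volume : Measure ℝ).restrict (Ici 0))
      (Prod.mk z ⁻¹' ((fun y : ℝ × ℝ => (y.1, y.2 + y.1 ^ 2)) ⁻¹' T)) =
      ENNReal.ofReal π * volume (Prod.mk z ⁻¹' (T ∩ {y | y.1 ^ 2 ≤ y.2})) := by
    intro z
    rw [Measure.smul_apply, Measure.restrict_apply (measurable_prodMk_left (hsm hTm)),
      smul_eq_mul, ← measure_preimage_add_right volume (z ^ 2) (Prod.mk z ⁻¹' (T ∩ {y | y.1 ^ 2 ≤ y.2}))]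
    congr 2
    ext q
    simp
  simp_rw [e2]
  rw [lintegral_const_mul _ (measurable_measure_prodMk_left hTm'), ← Measure.prod_apply hTm',
    Measure.prod_apply_symm hTm']
  have e3 : ∀ s : ℝ, volume ((fun z => (z, s)) ⁻¹' (T ∩ {y | y.1 ^ 2 ≤ y.2})) =
      (Ioo (0 : ℝ) 1).indicator (fun s => ENNReal.ofReal ((1 - t) * s ^ (1 / 2 : ℝ))) s := by
    intro s
    by_cases hs : s ∈ Ioo (0 : ℝ) 1
    · rw [indicator_of_mem hs]
      have : (fun z => (z, s)) ⁻¹' (T ∩ {y | y.1 ^ 2 ≤ y.2}) = Icc (t * √s) √s := by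
        ext z
        simp only [hT, mem_preimage, mem_inter_iff, mem_ofPred_eq, hs.1, hs.2, true_and, mem_Icc]
        refine and_congr_right fun h => ⟨Real.le_sqrt_of_sq_le, fun h' => ?_⟩
        rw [← Real.sq_sqrt hs.1.le]
        exact sq_le_sq' (by nlinarith [Real.sqrt_nonneg s]) h'
      rw [this, Real.volume_Icc, ← Real.sqrt_eq_rpow]
      ring_nf
    · rw [indicator_of_notMem hs]
      have : (fun z => (z, s)) ⁻¹' (T ∩ {y | y.1 ^ 2 ≤ y.2}) = ∅ := by
        ext z
        simp only [hT, mem_preimage, mem_inter_iff, mem_ofPred_eq, mem_empty_iff_false, iff_false]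
        exact fun h => hs ⟨h.1.1, h.1.2.1⟩
      rw [this, measure_empty]
  simp_rw [e3]
  rw [lintegral_indicator measurableSet_Ioo, restrict_Ioo_eq_restrict_Ioc,
    ← ofReal_integral_eq_lintegral_ofReal, ← intervalIntegral.integral_of_le zero_le_one,
    intervalIntegral.integral_const_mul, integral_rpow (by norm_num),
    ← ENNReal.ofReal_mul pi_pos.le]
  · norm_num; congr 1; ring
  · refine (IntervalIntegrable.const_mul ?_ _).1
    exact intervalIntegral.intervalIntegrable_rpow' (by norm_num)
  · filter_upwards [ae_restrict_mem measurableSet_Ioc] with s hs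
    exact mul_nonneg (by linarith) (rpow_nonneg hs.1.le _)

open scoped Pointwise in
/-- Archimedes' theorem: the area of a spherical cap of the unit sphere is `2π` times its
height. -/
theorem toSphere_cap {t : ℝ} (h1 : -1 ≤ t) (h2 : t ≤ 1) :
    (volume : Measure Space3).toSphere {u | t ≤ (u : Space3) 2} =
      ENNReal.ofReal (2 * π * (1 - t)) := by
  have hm : MeasurableSet {u : Metric.sphere (0 : Space3) 1 | t ≤ (u : Space3) 2} :=
    measurableSet_le measurable_const (by fun_prop)
  have : (Ioo (0 : ℝ) 1 • (Subtype.val '' {u : Metric.sphere (0 : Space3) 1 | t ≤ (u : Space3) 2}) :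
      Set Space3) = {x | 0 < ‖x‖ ∧ ‖x‖ < 1 ∧ t * ‖x‖ ≤ x 2} := by
    ext x
    simp only [Set.mem_smul, mem_image, mem_ofPred_eq, Subtype.exists, exists_and_right,
      exists_eq_right, mem_Ioo, mem_sphere_iff_norm, sub_zero]
    constructor
    · rintro ⟨a, ⟨ha, ha'⟩, u, ⟨hu, hu'⟩, rfl⟩
      rw [norm_smul, hu, Real.norm_of_nonneg ha.le]
      simp only [mul_one, PiLp.smul_apply, smul_eq_mul]
      exact ⟨ha, ha', by nlinarith⟩
    · rintro ⟨h0, h1, h⟩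
      refine ⟨‖x‖, ⟨h0, h1⟩, ‖x‖⁻¹ • x, ⟨?_, ?_⟩, ?_⟩
      · rw [norm_smul, norm_inv, norm_norm, inv_mul_cancel₀ h0.ne']
      · simp only [PiLp.smul_apply, smul_eq_mul]
        rw [inv_mul_eq_div, le_div_iff₀ h0]; exact h
      · rw [smul_smul, mul_inv_cancel₀ h0.ne', one_smul]
  rw [Measure.toSphere_apply' _ hm, this, volume_sector h1 h2, finrank_euclideanSpace_fin,
    ← ENNReal.ofReal_natCast, ← ENNReal.ofReal_mul (by positivity)]
  congr 1; push_cast; ring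

/-! ### The distance from the user to a random point of a sphere -/

theorem norm_sub_axis_sq (x : Space3) (a : ℝ) :
    ‖x - !₂[0, 0, a]‖ ^ 2 = ‖x‖ ^ 2 + a ^ 2 - 2 * a * x 2 := by
  rw [norm_sq_space3, norm_sq_space3]
  simp
  ring

theorem measurable_sphere_scale (R : ℝ) :
    Measurable fun u : Metric.sphere (0 : Space3) 1 => R • (u : Space3) := by
  fun_prop

instance isFiniteMeasure_sphereArea (R : ℝ) : IsFiniteMeasure (sphereArea R) := by
  have : IsFiniteMeasure (Measure.map (fun u : Metric.sphere (0 : Space3) 1 => R • (u : Space3))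
    (volume : Measure Space3).toSphere) := inferInstance
  exact ⟨by
    rw [sphereArea, Measure.smul_apply, smul_eq_mul]
    exact ENNReal.mul_lt_top ENNReal.ofReal_lt_top (measure_lt_top _ _)⟩

theorem sphereArea_apply (R : ℝ) {s : Set Space3} (hs : MeasurableSet s) :
    sphereArea R s = ENNReal.ofReal (R ^ 2) *
      (volume : Measure Space3).toSphere {u | R • (u : Space3) ∈ s} := by
  rw [sphereArea, Measure.smul_apply, Measure.map_apply (measurable_sphere_scale R) hs, smul_eq_mul]
  rfl

theorem ae_norm_sphereArea {R : ℝ} (hR : 0 ≤ R) : ∀ᵐ x ∂sphereArea R, ‖x‖ = R := by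
  have hm : MeasurableSet {x : Space3 | ‖x‖ = R} :=
    measurableSet_eq_fun (by fun_prop) measurable_const
  rw [ae_iff, show {x : Space3 | ¬‖x‖ = R} = {x : Space3 | ‖x‖ = R}ᶜ from rfl,
    sphereArea_apply R hm.compl]
  have : {u : Metric.sphere (0 : Space3) 1 | R • (u : Space3) ∈ {x : Space3 | ‖x‖ = R}ᶜ} = ∅ := by
    ext u
    simp [norm_smul, abs_of_nonneg hR]
  rw [this, measure_empty, mul_zero]

theorem sphereArea_univ {R : ℝ} : sphereArea R univ = ENNReal.ofReal (4 * π * R ^ 2) := by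
  have h := toSphere_cap (t := -1) le_rfl (by norm_num)
  have : {u : Metric.sphere (0 : Space3) 1 | -1 ≤ (u : Space3) 2} = univ := by
    ext u
    have h1 : ‖(u : Space3)‖ = 1 := by simp
    have h2 := norm_sq_space3 (u : Space3)
    rw [h1] at h2
    simp only [mem_ofPred_eq, mem_univ, iff_true]
    nlinarith [sq_nonneg ((u : Space3) 0), sq_nonneg ((u : Space3) 1)]
  rw [this] at h
  rw [sphereArea_apply R MeasurableSet.univ]
  simp only [mem_univ, ofPred_true]
  rw [h, ← ENNReal.ofReal_mul (by positivity)]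
  congr 1; ring

theorem measurable_norm_sub (u : Space3) : Measurable fun x : Space3 => ‖x - u‖ := by fun_prop

/-- The points of a sphere within distance `r` of the point at height `a` form a spherical cap,
whose area is proportional to its height and hence quadratic in `r`. -/
theorem sphereArea_dist_le {R a r : ℝ} (ha : 0 < a) (haR : a ≤ R) (hr : R - a ≤ r)
    (hr' : r ≤ R + a) :
    sphereArea R {x | ‖x - !₂[0, 0, a]‖ ≤ r} =
      ENNReal.ofReal (π * (R / a) * (r ^ 2 - (R - a) ^ 2)) := by
  have hR : 0 < R := ha.trans_le haR
  have hr0 : 0 ≤ r := by linarith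
  rw [sphereArea_apply R (measurableSet_le (by fun_prop) measurable_const)]
  set t := (R ^ 2 + a ^ 2 - r ^ 2) / (2 * a * R) with ht
  have hd : 0 < 2 * a * R := by positivity
  have : {u : Metric.sphere (0 : Space3) 1 | R • (u : Space3) ∈ {x : Space3 |
      ‖x - !₂[0, 0, a]‖ ≤ r}} = {u : Metric.sphere (0 : Space3) 1 | t ≤ (u : Space3) 2} := by
    ext u
    have h1 : ‖(u : Space3)‖ = 1 := by simp
    simp only [mem_ofPred_eq]
    rw [← sq_le_sq₀ (norm_nonneg _) hr0, norm_sub_axis_sq, norm_smul, h1, ht, div_le_iff₀ hd]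
    simp only [mul_one, Real.norm_eq_abs, sq_abs, PiLp.smul_apply, smul_eq_mul]
    constructor <;> intro h <;> nlinarith
  rw [this, toSphere_cap, ← ENNReal.ofReal_mul (by positivity)]
  · congr 1
    rw [ht]; field_simp; ring
  · rw [ht, le_div_iff₀ hd]; nlinarith
  · rw [ht, div_le_iff₀ hd]; nlinarith

/-- The distance from a point at height `a` to a point spread by area over the sphere of radius
`R ≥ a` has the linear density of a planar disc, rescaled by `R / a`. -/
theorem map_dist_sphereArea {R a : ℝ} (ha : 0 < a) (haR : a ≤ R) :
    (sphereArea R).map (fun x => ‖x - !₂[0, 0, a]‖) =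
      (volume.restrict (Ioc (R - a) (R + a))).withDensity
        fun v => ENNReal.ofReal (2 * π * (R / a) * v) := by
  have hR : 0 < R := ha.trans_le haR
  have hm := measurable_norm_sub !₂[0, 0, a]
  have key : ∀ m, R - a ≤ m → ∫⁻ v in Ioc (R - a) m, ENNReal.ofReal (2 * π * (R / a) * v) =
      ENNReal.ofReal (π * (R / a) * (m ^ 2 - (R - a) ^ 2)) := by
    intro m hm
    rw [← ofReal_integral_eq_lintegral_ofReal, ← intervalIntegral.integral_of_le hm,
      intervalIntegral.integral_const_mul, integral_id]
    · congr 1; ring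
    · exact (Continuous.intervalIntegrable (by fun_prop) _ _).1
    · filter_upwards [ae_restrict_mem measurableSet_Ioc] with s hs
      have : 0 ≤ s := by linarith [hs.1]
      positivity
  refine Measure.ext_of_Iic _ _ fun r => ?_
  rw [Measure.map_apply hm measurableSet_Iic, withDensity_apply _ measurableSet_Iic,
    Measure.restrict_restrict measurableSet_Iic]
  change sphereArea R {x | ‖x - !₂[0, 0, a]‖ ≤ r} = _
  rcases lt_or_ge r (R - a) with h | h
  · have e : Iic r ∩ Ioc (R - a) (R + a) = ∅ := by
      ext v; simp only [mem_inter_iff, mem_Iic, mem_Ioc, mem_empty_iff_false, iff_false]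
      intro h'; linarith [h'.1, h'.2.1]
    have z := sphereArea_dist_le ha haR le_rfl (by linarith : R - a ≤ R + a)
    rw [sub_self, mul_zero, ENNReal.ofReal_zero] at z
    rw [e, Measure.restrict_empty, lintegral_zero_measure]
    exact measure_mono_null (fun x hx => le_trans hx h.le) z
  rcases le_or_gt r (R + a) with h' | h'
  · have e : Iic r ∩ Ioc (R - a) (R + a) = Ioc (R - a) r := by
      ext v; simp only [mem_inter_iff, mem_Iic, mem_Ioc]
      exact ⟨fun h => ⟨h.2.1, h.1⟩, fun h => ⟨h.2, h.1, h.2.trans h'⟩⟩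
    rw [e, key r h, sphereArea_dist_le ha haR h h']
  · have e : Iic r ∩ Ioc (R - a) (R + a) = Ioc (R - a) (R + a) := by
      rw [inter_eq_right]
      exact fun v hv => hv.2.trans h'.le
    rw [e, key _ (by linarith)]
    refine le_antisymm ?_ ?_
    · refine (measure_mono (subset_univ _)).trans_eq ?_
      rw [sphereArea_univ]
      congr 1; field_simp; ring
    · rw [← sphereArea_dist_le ha haR (by linarith) le_rfl]
      exact measure_mono fun x (hx : _ ≤ _) => hx.trans h'.le

theorem lintegral_sphereArea_dist {R a ρ : ℝ} (ha : 0 < a) (haR : a ≤ R)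
    (hρ : ρ ≤ R + a) {A : Set Space3}
    (hA : ∀ᵐ x ∂sphereArea R, x ∈ A ↔ ‖x - !₂[0, 0, a]‖ ≤ ρ)
    {φ : ℝ → ENNReal} (hφ : Measurable φ) :
    ∫⁻ x, A.indicator (fun x => φ ‖x - !₂[0, 0, a]‖) x ∂sphereArea R =
      ∫⁻ v in Ioc (R - a) ρ, ENNReal.ofReal (2 * π * (R / a) * v) * φ v := by
  have h1 : ∫⁻ x, A.indicator (fun x => φ ‖x - !₂[0, 0, a]‖) x ∂sphereArea R =
      ∫⁻ x, (Iic ρ).indicator φ ‖x - !₂[0, 0, a]‖ ∂sphereArea R := by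
    refine lintegral_congr_ae ?_
    filter_upwards [hA] with x hx
    simp only [indicator, mem_Iic, hx]
  have hφ' : Measurable ((Iic ρ).indicator φ) := hφ.indicator measurableSet_Iic
  rw [h1, ← lintegral_map hφ' (measurable_norm_sub _), map_dist_sphereArea ha haR,
    lintegral_withDensity_eq_lintegral_mul _ (by fun_prop) hφ']
  have : ∀ v, ((fun v => ENNReal.ofReal (2 * π * (R / a) * v)) * (Iic ρ).indicator φ) v =
      (Iic ρ).indicator (fun v => ENNReal.ofReal (2 * π * (R / a) * v) * φ v) v := by
    intro v
    by_cases hv : v ∈ Iic ρ <;> simp [hv, indicator]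
  simp_rw [this]
  rw [lintegral_indicator measurableSet_Iic, Measure.restrict_restrict measurableSet_Iic]
  congr 2
  ext v
  simp only [mem_inter_iff, mem_Iic, mem_Ioc]
  constructor
  · exact fun h => ⟨h.2.1, h.1⟩
  · exact fun h => ⟨h.2, h.1, h.2.trans hρ⟩

namespace NetworkParams
variable (p : NetworkParams)

/-- On the sphere of radius `R`, the elevation angle decreases with the distance to the user, so the
visible points are those within distance `Rmax R`. -/
theorem mem_visibleCap_iff (hU : 0 < p.RU) {R : ℝ} (hR : p.RU < R) {x : Space3} (hx : ‖x‖ = R) :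
    x ∈ p.visibleCap R ↔ ‖x - p.user‖ ≤ p.Rmax R := by
  set d := ‖x - p.user‖ with hd
  have h1 : d ^ 2 = R ^ 2 + p.RU ^ 2 - 2 * p.RU * x 2 := by
    rw [hd, user, norm_sub_axis_sq, hx]
  have hd0 : 0 ≤ d := norm_nonneg _
  have hpos : 0 ≤ R ^ 2 - p.RU ^ 2 + p.RU ^ 2 * sin p.theta ^ 2 := by
    nlinarith [sq_nonneg (p.RU * sin p.theta)]
  have hlow : 0 ≤ d + p.RU * sin p.theta + √(R ^ 2 - p.RU ^ 2 + p.RU ^ 2 * sin p.theta ^ 2) := by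
    have : -(p.RU * sin p.theta) ≤ √(R ^ 2 - p.RU ^ 2 + p.RU ^ 2 * sin p.theta ^ 2) :=
      Real.le_sqrt_of_sq_le (by nlinarith)
    linarith
  have h2 : x ∈ p.visibleCap R ↔
      (d + p.RU * sin p.theta) ^ 2 ≤ R ^ 2 - p.RU ^ 2 + p.RU ^ 2 * sin p.theta ^ 2 := by
    simp only [visibleCap, mem_ofPred_eq, hx, true_and, ← hd]
    constructor <;> intro h <;> nlinarith
  rw [h2, Rmax, le_sub_iff_add_le]
  refine ⟨Real.le_sqrt_of_sq_le, fun h => ?_⟩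
  rw [← Real.sq_sqrt hpos]
  exact sq_le_sq' (by linarith) h

theorem Rmax_le (hU : 0 < p.RU) {R : ℝ} (hR : p.RU < R) : p.Rmax R ≤ R + p.RU := by
  have h1 : √(R ^ 2 - p.RU ^ 2 + p.RU ^ 2 * sin p.theta ^ 2) ≤ R := by
    refine Real.sqrt_le_iff.2 ⟨by linarith, ?_⟩
    nlinarith [sin_sq_le_one p.theta, sq_nonneg p.RU]
  have := neg_one_le_sin p.theta
  rw [Rmax]
  nlinarith

theorem Rmin_lt_Rmax (hU : 0 < p.RU) {R : ℝ} (hR : p.RU < R) (h1 : -(π / 2) < p.theta)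
    (h2 : p.theta < π / 2) : p.Rmin R < p.Rmax R := by
  have hs : sin p.theta < 1 := by
    rw [← sin_pi_div_two]; exact sin_lt_sin_of_lt_of_le_pi_div_two h1.le le_rfl h2
  rw [Rmin, Rmax, lt_sub_iff_add_lt]
  apply Real.lt_sqrt_of_sq_lt
  nlinarith [mul_pos (mul_pos hU (sub_pos.2 hs)) (sub_pos.2 hR)]

theorem measurableSet_visibleCap (R : ℝ) : MeasurableSet (p.visibleCap R) :=
  (measurableSet_eq_fun (f := fun x : Space3 => ‖x‖) (by fun_prop) measurable_const).inter
    (measurableSet_le (f := fun x : Space3 => ‖x - p.user‖ * sin p.theta) (by fun_prop)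
      (by fun_prop))

theorem measurableSet_visibleDisc : MeasurableSet p.visibleDisc :=
  (measurableSet_eq_fun (f := fun x : Space3 => ‖x‖) (by fun_prop) measurable_const).inter
    (measurableSet_le (f := fun x : Space3 => ‖x - p.user‖) (by fun_prop) measurable_const)

end NetworkParams

/-! ### Poisson processes: Laplace functional and Mecke formula -/

/-- The random variables `z 0, …, z (N - 1)` form a Poisson process of intensity `lam • ρ`, where
`ρ` is a probability measure, independent of the variable `J`, whose law is `τ`: the number `N`
of points is Poisson with mean `lam`, and on `N = n` the points are independent with law `ρ`. -/
structure IsPoissonWith {Ω Z T : Type*} [MeasurableSpace Ω] [MeasurableSpace Z]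
    [MeasurableSpace T] (P : Measure Ω) (lam : NNReal) (ρ : Measure Z) (τ : Measure T)
    (N : Ω → ℕ) (z : ℕ → Ω → Z) (J : Ω → T) : Prop where
  measurable_card : Measurable N
  measurable_point : ∀ i, Measurable (z i)
  measurable_side : Measurable J
  law : ∀ n : ℕ, (P.restrict (N ⁻¹' {n})).map (fun ω => (fun i : Fin n => z i ω, J ω)) =
    poissonMeasure lam {n} • (Measure.pi fun _ : Fin n => ρ).prod τ

theorem poissonMeasure_succ_mul (lam : NNReal) (n : ℕ) :
    poissonMeasure lam {n + 1} * ((n + 1 : ℕ) : ENNReal) = lam * poissonMeasure lam {n} := by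
  rw [poissonMeasure_singleton, poissonMeasure_singleton, ← ENNReal.ofReal_natCast,
    ← ENNReal.ofReal_mul (by positivity), ← ENNReal.ofReal_coe_nnreal,
    ← ENNReal.ofReal_mul (by positivity)]
  congr 1
  rw [Nat.factorial_succ]
  push_cast
  field_simp
  ring

/-- The probability generating function of a Poisson variable. -/
theorem tsum_poissonMeasure_mul_pow (lam : NNReal) {q : ENNReal} (hq : q ≠ ⊤) :
    ∑' n : ℕ, poissonMeasure lam {n} * q ^ n =
      ENNReal.ofReal (exp (-(lam * (1 - q.toReal)))) := by
  have h : HasSum (fun n : ℕ => exp (-lam) * (lam * q.toReal) ^ n / (n.factorial : ℝ))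
      (exp (-(lam * (1 - q.toReal)))) := by
    have h1 := (NormedSpace.expSeries_div_hasSum_exp (lam * q.toReal : ℝ)).mul_left (exp (-lam))
    rw [← Real.exp_eq_exp_ℝ, ← Real.exp_add] at h1
    convert! h1 using 1
    · funext n; ring
    · congr 1; ring
  rw [← h.tsum_eq, ENNReal.ofReal_tsum_of_nonneg (fun n => by positivity) h.summable]
  refine tsum_congr fun n => ?_
  conv_lhs => rw [poissonMeasure_singleton, ← ENNReal.ofReal_toReal hq]
  rw [← ENNReal.ofReal_pow ENNReal.toReal_nonneg, ← ENNReal.ofReal_mul (by positivity)]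
  congr 1
  rw [mul_pow]; ring

theorem lintegral_pi_prod {Z : Type*} [MeasurableSpace Z] (ρ : Measure Z) [IsProbabilityMeasure ρ]
    {g : Z → ENNReal} (hg : Measurable g) (n : ℕ) :
    ∫⁻ z, ∏ i, g (z i) ∂(Measure.pi fun _ : Fin n => ρ) = (∫⁻ ξ, g ξ ∂ρ) ^ n := by
  refine (lintegral_prod_eq_prod_lintegral_of_indepFun Finset.univ
    (fun (i : Fin n) (z : Fin n → Z) => g (z i))
    (iIndepFun_pi fun i => hg.aemeasurable) (fun i => by fun_prop)).trans ?_
  simp_rw [fun i : Fin n => (measurePreserving_eval (fun _ : Fin n => ρ) i).lintegral_comp hg]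
  simp

/-- Singling out the coordinate `i` of a product measure. -/
theorem measurePreserving_single_out {Z T : Type*} [MeasurableSpace Z] [MeasurableSpace T]
    (ρ : Measure Z) [SigmaFinite ρ] (τ : Measure T) [SFinite τ] {n : ℕ} (i : Fin (n + 1)) :
    MeasurePreserving
      (fun y : (Fin (n + 1) → Z) × T => (y.1 i, (fun j => y.1 (i.succAbove j)), y.2))
      ((Measure.pi fun _ => ρ).prod τ) (ρ.prod ((Measure.pi fun _ : Fin n => ρ).prod τ)) :=
  (measurePreserving_prodAssoc _ _ _).comp
    ((measurePreserving_piFinSuccAbove (fun _ : Fin (n + 1) => ρ) i).prod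
      (MeasurePreserving.id τ))

namespace IsPoissonWith

variable {Ω Z T : Type*} [MeasurableSpace Ω] [MeasurableSpace Z] [MeasurableSpace T]
  {P : Measure Ω} {lam : NNReal} {ρ : Measure Z} {τ : Measure T} {N : Ω → ℕ} {z : ℕ → Ω → Z}
  {J : Ω → T}

theorem measurable_points (h : IsPoissonWith P lam ρ τ N z J) (n : ℕ) :
    Measurable fun ω => (fun i : Fin n => z i ω, J ω) :=
  (measurable_pi_lambda _ fun i : Fin n => h.measurable_point i).prodMk h.measurable_side

theorem measurable_comp_prod (h : IsPoissonWith P lam ρ τ N z J) {S β : Type*}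
    [MeasurableSpace S] [MeasurableSpace β] {Φ : ∀ n : ℕ, S → (Fin n → Z) × T → β}
    (hΦ : ∀ n, Measurable (Function.uncurry (Φ n))) :
    Measurable fun a : S × Ω => Φ (N a.2) a.1 (fun i => z i a.2, J a.2) := by
  have : Measurable fun y : ℕ × (S × Ω) => Φ y.1 y.2.1 (fun i => z i y.2.2, J y.2.2) := by
    refine measurable_from_prod_countable_right fun n => ?_
    exact (hΦ n).comp (measurable_fst.prodMk ((h.measurable_points n).comp measurable_snd))
  exact this.comp ((h.measurable_card.comp measurable_snd).prodMk measurable_id)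

theorem measurable_comp (h : IsPoissonWith P lam ρ τ N z J) {β : Type*} [MeasurableSpace β]
    {Φ : ∀ n : ℕ, (Fin n → Z) × T → β} (hΦ : ∀ n, Measurable (Φ n)) :
    Measurable fun ω => Φ (N ω) (fun i => z i ω, J ω) :=
  (h.measurable_comp_prod (S := Unit) (Φ := fun n _ y => Φ n y)
    fun n => (hΦ n).comp measurable_snd).comp ((measurable_const (a := ())).prodMk measurable_id)

theorem lintegral_eq_tsum (h : IsPoissonWith P lam ρ τ N z J)
    {Φ : ∀ n : ℕ, (Fin n → Z) × T → ENNReal} (hΦ : ∀ n, Measurable (Φ n)) :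
    ∫⁻ ω, Φ (N ω) (fun i => z i ω, J ω) ∂P =
      ∑' n, poissonMeasure lam {n} * ∫⁻ y, Φ n y ∂(Measure.pi fun _ : Fin n => ρ).prod τ := by
  have hm : ∀ n, MeasurableSet (N ⁻¹' {n}) := fun n => h.measurable_card (measurableSet_singleton n)
  rw [← setLIntegral_univ, ← preimage_univ (f := N), ← iUnion_of_singleton ℕ, preimage_iUnion,
    lintegral_iUnion hm]
  · refine tsum_congr fun n => ?_
    rw [← smul_eq_mul, ← lintegral_smul_measure, ← h.law n,
      lintegral_map (hΦ n) (h.measurable_points n)]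
    refine setLIntegral_congr_fun (hm n) fun ω hω => ?_
    obtain rfl : N ω = n := hω
    rfl
  · intro m n hmn
    rw [Function.onFun, Set.disjoint_left]
    intro ω h1 h2
    exact hmn (h1.symm.trans h2)

/-- The Laplace functional of a Poisson process. -/
theorem lintegral_prod_mul (h : IsPoissonWith P lam ρ τ N z J) [IsProbabilityMeasure ρ]
    [SFinite τ] {g : Z → ENNReal} (hg : Measurable g) (hq : ∫⁻ ξ, g ξ ∂ρ ≠ ⊤)
    {k : T → ENNReal} (hk : Measurable k) :
    ∫⁻ ω, (∏ i : Fin (N ω), g (z i ω)) * k (J ω) ∂P =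
      ENNReal.ofReal (exp (-(lam * (1 - (∫⁻ ξ, g ξ ∂ρ).toReal)))) * ∫⁻ t, k t ∂τ := by
  rw [h.lintegral_eq_tsum (Φ := fun n y => (∏ i, g (y.1 i)) * k y.2) (fun n => by fun_prop),
    ← tsum_poissonMeasure_mul_pow lam hq, ← ENNReal.tsum_mul_right]
  refine tsum_congr fun n => ?_
  rw [MeasureTheory.lintegral_prod_mul (f := fun y : Fin n → Z => ∏ i, g (y i))
    (Measurable.aemeasurable (by fun_prop)) hk.aemeasurable,
    lintegral_pi_prod ρ hg, mul_assoc]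

/-- The Mecke formula for a Poisson process: the expected sum over the points `ξ` of a functional
of `ξ` and of the configuration of the other points is an integral over `ξ` against the
intensity, with an independent copy of the whole process in place of the other points. -/
theorem mecke (h : IsPoissonWith P lam ρ τ N z J) [IsProbabilityMeasure ρ] [SFinite τ]
    [SFinite P] {Φ : ∀ n : ℕ, (Fin n → Z) × T → ENNReal}
    {Ψ : ∀ n : ℕ, Z → (Fin n → Z) × T → ENNReal}
    (hΨ : ∀ n, Measurable (Function.uncurry (Ψ n))) (h0 : ∀ y, Φ 0 y = 0)
    (hsucc : ∀ n y, Φ (n + 1) y = ∑ i, Ψ n (y.1 i) (fun j => y.1 (i.succAbove j), y.2)) :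
    ∫⁻ ω, Φ (N ω) (fun i => z i ω, J ω) ∂P =
      lam * ∫⁻ ξ, ∫⁻ ω, Ψ (N ω) ξ (fun i => z i ω, J ω) ∂P ∂ρ := by
  have hi : ∀ n (i : Fin (n + 1)), Measurable fun y : (Fin (n + 1) → Z) × T =>
      Ψ n (y.1 i) (fun j => y.1 (i.succAbove j), y.2) := fun n i =>
    (hΨ n).comp (measurePreserving_single_out ρ τ i).measurable
  have hΦ : ∀ n, Measurable (Φ n) := by
    intro n
    cases n with
    | zero => rw [show Φ 0 = fun _ => 0 from funext h0]; exact measurable_const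
    | succ n =>
      rw [show Φ (n + 1) = _ from funext (hsucc n)]
      exact Finset.measurable_sum _ fun i _ => hi n i
  have hΨ' : ∀ n ξ, Measurable (Ψ n ξ) := fun n ξ => (hΨ n).comp measurable_prodMk_left
  simp_rw [fun ξ => h.lintegral_eq_tsum (Φ := fun n => Ψ n ξ) (fun n => hΨ' n ξ)]
  have hI : ∀ n, Measurable fun ξ => ∫⁻ y, Ψ n ξ y ∂(Measure.pi fun _ : Fin n => ρ).prod τ :=
    fun n => (hΨ n).lintegral_prod_right'
  rw [h.lintegral_eq_tsum hΦ, lintegral_tsum fun n => ((hI n).const_mul _).aemeasurable,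
    ← ENNReal.tsum_mul_left, tsum_eq_zero_add' ENNReal.summable]
  simp only [h0, lintegral_zero, mul_zero, zero_add]
  refine tsum_congr fun n => ?_
  rw [lintegral_const_mul _ (hI n), ← mul_assoc, ← poissonMeasure_succ_mul, mul_assoc]
  congr 1
  simp_rw [hsucc]
  rw [lintegral_finsetSum _ fun i _ => hi n i]
  have : ∀ i : Fin (n + 1), ∫⁻ y : (Fin (n + 1) → Z) × T,
      Ψ n (y.1 i) (fun j => y.1 (i.succAbove j), y.2) ∂(Measure.pi fun _ => ρ).prod τ =
      ∫⁻ ξ, ∫⁻ y, Ψ n ξ y ∂(Measure.pi fun _ : Fin n => ρ).prod τ ∂ρ := by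
    intro i
    exact ((measurePreserving_single_out ρ τ i).lintegral_comp (hΨ n)).trans
      (lintegral_prod _ (hΨ n).aemeasurable)
  simp_rw [this]
  simp

/-- If the level sets of `D` are null, then almost surely no two points have the same `D`-value. -/
theorem ae_ne (h : IsPoissonWith P lam ρ τ N z J) [IsProbabilityMeasure ρ] [SFinite τ]
    {D : Z → ℝ} (hD : Measurable D) (hnull : ∀ r, ρ {ξ | D ξ = r} = 0) :
    ∀ᵐ ω ∂P, ∀ i < N ω, ∀ j < N ω, i ≠ j → D (z i ω) ≠ D (z j ω) := by
  have hm : ∀ n, MeasurableSet (N ⁻¹' {n}) := fun n => h.measurable_card (measurableSet_singleton n)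
  have key : ∀ n i j : ℕ, i < n → j < n → i ≠ j →
      ∀ᵐ ω ∂P, N ω = n → D (z i ω) ≠ D (z j ω) := by
    intro n i j hi hj hij
    change ∀ᵐ ω ∂P, ω ∈ N ⁻¹' {n} → _
    rw [← ae_restrict_iff' (hm n)]
    have hS : MeasurableSet {a : Z × Z | D a.1 = D a.2} :=
      measurableSet_eq_fun (by fun_prop) (by fun_prop)
    have h0 : (ρ.prod ρ) {a : Z × Z | D a.1 = D a.2} = 0 := by
      rw [Measure.prod_apply hS]
      refine (lintegral_congr fun ξ => ?_).trans lintegral_zero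
      rw [← hnull (D ξ)]
      congr 1
      ext ξ'
      exact eq_comm
    have h1 : (Measure.pi fun _ : Fin n => ρ).map (fun y => (y ⟨i, hi⟩, y ⟨j, hj⟩)) = ρ.prod ρ := by
      have hind : iIndepFun (fun (k : Fin n) (y : Fin n → Z) => y k)
          (Measure.pi fun _ : Fin n => ρ) :=
        iIndepFun_pi (X := fun (_ : Fin n) (ξ : Z) => ξ) fun _ => aemeasurable_id
      have h2 := (indepFun_iff_map_prod_eq_prod_map_map
        (measurable_pi_apply _).aemeasurable (measurable_pi_apply _).aemeasurable).1
        (hind.indepFun (i := ⟨i, hi⟩) (j := ⟨j, hj⟩) (by simpa using hij))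
      rw [h2]
      congr 1
      · exact (measurePreserving_eval (fun _ : Fin n => ρ) ⟨i, hi⟩).map_eq
      · exact (measurePreserving_eval (fun _ : Fin n => ρ) ⟨j, hj⟩).map_eq
    have hpm : Measurable fun y : Fin n → Z => (y ⟨i, hi⟩, y ⟨j, hj⟩) := by fun_prop
    have h3 : ((Measure.pi fun _ : Fin n => ρ).prod τ)
        (((fun y : Fin n → Z => (y ⟨i, hi⟩, y ⟨j, hj⟩)) ⁻¹' {a | D a.1 = D a.2}) ×ˢ univ) = 0 := by
      rw [Measure.prod_prod, ← Measure.map_apply hpm hS, h1, h0, zero_mul]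
    have h4 := Measure.map_apply (μ := P.restrict (N ⁻¹' {n})) (h.measurable_points n)
      ((hpm hS).prod MeasurableSet.univ)
    rw [h.law n, Measure.smul_apply, h3, smul_zero] at h4
    rw [ae_iff]
    refine measure_mono_null (fun ω hω => ?_) h4.symm
    simpa using hω
  have := fun n i j => ae_all_iff.2 fun hi => ae_all_iff.2 fun hj =>
    ae_all_iff.2 fun hij => key n i j hi hj hij
  filter_upwards [ae_all_iff.2 fun n => ae_all_iff.2 fun i => ae_all_iff.2 fun j => this n i j]
    with ω hω i hi j hj hij
  exact hω (N ω) i j hi hj hij rfl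

end IsPoissonWith

/-! ### Marked spherical Poisson processes -/

/-- The uniform distribution on the sphere of radius `R` centred at the origin. -/
noncomputable def sphereUniform (R : ℝ) : Measure Space3 := (sphereArea R univ)⁻¹ • sphereArea R

theorem isProbabilityMeasure_sphereUniform {R : ℝ} (hR : 0 < R) :
    IsProbabilityMeasure (sphereUniform R) := by
  refine ⟨?_⟩
  rw [sphereUniform, Measure.smul_apply, smul_eq_mul]
  refine ENNReal.inv_mul_cancel ?_ (measure_ne_top _ _)
  rw [sphereArea_univ]
  exact (ENNReal.ofReal_pos.2 (by positivity)).ne'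

/-- The intensity measure of a spherical Poisson process is the area measure times the density. -/
theorem ofReal_density_smul_sphereUniform {R lam : ℝ} (hR : 0 < R) (hlam : 0 < lam) :
    ((lam * (sphereArea R).real univ).toNNReal : ENNReal) • sphereUniform R =
      ENNReal.ofReal lam • sphereArea R := by
  have h0 : sphereArea R univ ≠ 0 := by
    rw [sphereArea_univ]
    exact (ENNReal.ofReal_pos.2 (by positivity)).ne'
  rw [sphereUniform, smul_smul]
  congr 1
  change ENNReal.ofReal _ * _ = _
  rw [ENNReal.ofReal_mul hlam.le, ofReal_measureReal, mul_assoc,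
    ENNReal.mul_inv_cancel h0 (measure_ne_top _ _), mul_one]

section

variable {Ω : Type*} [MeasurableSpace Ω] {P : Measure Ω} {R lam : ℝ}
  {N : Ω → ℕ} {x : ℕ → Ω → Space3}

/-- On the event `N = n`, the law of the points is a product of uniform distributions, and not only
on boxes. -/
theorem IsSphericalPoisson.restrict_map (hx : IsSphericalPoisson P R lam N x) (hR : 0 < R)
    (hlam : 0 < lam) (n : ℕ) :
    (P.restrict (N ⁻¹' {n})).map (fun ω (i : Fin n) => x i ω) =
      poissonMeasure (lam * (sphereArea R).real univ).toNNReal {n} •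
        Measure.pi fun _ : Fin n => sphereUniform R := by
  have := isProbabilityMeasure_sphereUniform hR
  set c := poissonMeasure (lam * (sphereArea R).real univ).toNNReal {n} with hc
  have hpos : 0 < lam * (sphereArea R).real univ := by
    rw [measureReal_def, sphereArea_univ, ENNReal.toReal_ofReal (by positivity)]
    positivity
  have hc0 : c ≠ 0 := by
    have := poissonMeasure_real_singleton_pos n (Real.toNNReal_pos.2 hpos)
    rw [measureReal_def] at this
    exact (ENNReal.toReal_pos_iff.1 this).1.ne'
  have hct : c ≠ ⊤ := measure_ne_top _ _
  have hm : Measurable fun ω (i : Fin n) => x i ω :=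
    measurable_pi_lambda _ fun i => hx.measurable_point i
  have h1 : (Measure.pi fun _ : Fin n => sphereUniform R) =
      c⁻¹ • (P.restrict (N ⁻¹' {n})).map (fun ω (i : Fin n) => x i ω) := by
    refine Measure.pi_eq fun B hB => ?_
    have hBm : MeasurableSet (univ.pi B) := MeasurableSet.univ_pi hB
    rw [Measure.smul_apply, Measure.map_apply hm hBm, Measure.restrict_apply (hm hBm)]
    have : (fun ω (i : Fin n) => x i ω) ⁻¹' univ.pi B ∩ N ⁻¹' {n} =
        {ω | N ω = n ∧ ∀ i : Fin n, x i ω ∈ B i} := by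
      ext ω; simp [and_comm]
    rw [this, hx.law n B hB, ← hc, smul_eq_mul, ← mul_assoc, ENNReal.inv_mul_cancel hc0 hct,
      one_mul]
    rfl
  rw [h1, smul_smul, ENNReal.mul_inv_cancel hc0 hct, one_smul]

/-- Marking the points of a spherical Poisson process with independent, identically distributed
gains gives a Poisson process of pairs. -/
theorem IsSphericalPoisson.isPoissonWith [IsProbabilityMeasure P] {T : Type*} [MeasurableSpace T]
    (hx : IsSphericalPoisson P R lam N x) (hR : 0 < R) (hlam : 0 < lam)
    {H : ℕ → Ω → ℝ} (hHm : ∀ i, Measurable (H i)) (hH : iIndepFun H P) {ρH : Measure ℝ}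
    [IsProbabilityMeasure ρH] (hHlaw : ∀ i, P.map (H i) = ρH) {J : Ω → T} (hJ : Measurable J)
    (hxH : IndepFun (fun ω => (N ω, fun i => x i ω)) (fun ω i => H i ω) P)
    (hxHJ : IndepFun (fun ω => ((N ω, fun i => x i ω), fun i => H i ω)) J P) :
    IsPoissonWith P (lam * (sphereArea R).real univ).toNNReal ((sphereUniform R).prod ρH)
      (P.map J) N (fun i ω => (x i ω, H i ω)) J := by
  have := isProbabilityMeasure_sphereUniform hR
  refine ⟨hx.measurable_card, fun i => (hx.measurable_point i).prodMk (hHm i), hJ, fun n => ?_⟩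
  have hNx : Measurable fun ω => (N ω, fun i => x i ω) :=
    hx.measurable_card.prodMk (measurable_pi_lambda _ hx.measurable_point)
  have hHm' : Measurable fun ω i => H i ω := measurable_pi_lambda _ hHm
  have hjm : Measurable fun ω => (((N ω, fun i => x i ω), fun i => H i ω), J ω) :=
    (hNx.prodMk hHm').prodMk hJ
  have hjoint := (indepFun_iff_map_prod_eq_prod_map_map (hNx.prodMk hHm').aemeasurable
    hJ.aemeasurable).1 hxHJ
  rw [(indepFun_iff_map_prod_eq_prod_map_map hNx.aemeasurable hHm'.aemeasurable).1 hxH] at hjoint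
  set S : Set ((ℕ × (ℕ → Space3)) × (ℕ → ℝ)) := ({n} ×ˢ univ) ×ˢ univ
  have hS1 : MeasurableSet (({n} : Set ℕ) ×ˢ (univ : Set (ℕ → Space3))) :=
    (measurableSet_singleton n).prod MeasurableSet.univ
  have hS : MeasurableSet (S ×ˢ (univ : Set T)) :=
    (hS1.prod MeasurableSet.univ).prod MeasurableSet.univ
  let e := (MeasurableEquiv.arrowProdEquivProdArrow Space3 ℝ (Fin n)).symm
  let f1 : ℕ × (ℕ → Space3) → Fin n → Space3 := fun a i => a.2 i
  let f2 : (ℕ → ℝ) → Fin n → ℝ := fun h i => h i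
  have hf1 : Measurable f1 :=
    measurable_pi_lambda _ fun i => (measurable_pi_apply (i : ℕ)).comp measurable_snd
  have hf2 : Measurable f2 := measurable_pi_lambda _ fun i => measurable_pi_apply (i : ℕ)
  have hψ : Measurable (Prod.map (e ∘ Prod.map f1 f2) (id : T → T)) :=
    (e.measurable.comp (hf1.prodMap hf2)).prodMap measurable_id
  -- the law of the positions on `N = n`
  have hA : ((P.map fun ω => (N ω, fun i => x i ω)).restrict ({n} ×ˢ univ)).map f1 =
      poissonMeasure (lam * (sphereArea R).real univ).toNNReal {n} •
        Measure.pi fun _ : Fin n => sphereUniform R := by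
    rw [Measure.restrict_map hNx hS1, Measure.map_map hf1 hNx, ← hx.restrict_map hR hlam n]
    congr 2
    ext ω; simp
  -- the law of the gains
  have hB : (P.map fun ω i => H i ω).map f2 = Measure.pi fun _ : Fin n => ρH := by
    rw [Measure.map_map hf2 hHm']
    have := (iIndepFun_iff_map_fun_eq_pi_map fun i : Fin n => (hHm i).aemeasurable).1
      (hH.precomp (g := fun i : Fin n => (i : ℕ)) Fin.val_injective)
    simp_rw [hHlaw] at this
    exact this
  have h1 : (P.restrict (N ⁻¹' {n})).map (fun ω => (fun i : Fin n => (x i ω, H i ω), J ω)) =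
      ((P.map fun ω => (((N ω, fun i => x i ω), fun i => H i ω), J ω)).restrict
        (S ×ˢ univ)).map (Prod.map (e ∘ Prod.map f1 f2) id) := by
    rw [Measure.restrict_map hjm hS, Measure.map_map hψ hjm]
    congr 2
    ext ω; simp [S]
  rw [h1, hjoint, ← Measure.prod_restrict, ← Measure.prod_restrict, Measure.restrict_univ,
    Measure.restrict_univ, ← Measure.map_prod_map _ _
    (e.measurable.comp (hf1.prodMap hf2)) measurable_id, Measure.map_id,
    ← Measure.map_map e.measurable (hf1.prodMap hf2), ← Measure.map_prod_map _ _ hf1 hf2, hA, hB,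
    Measure.prod_smul_left, Measure.map_smul, Measure.prod_smul_left]
  congr 2
  exact ((measurePreserving_arrowProdEquivProdArrow Space3 ℝ (Fin n)
    (fun _ => sphereUniform R) (fun _ => ρH)).symm _).map_eq

end

/-! ### Kummer's transformation and Erlang tails -/

/-- Kummer's transformation turns `₁F₁(m; 1; x)`, for a positive integer `m`, into an exponential
times a polynomial. The identity of power series is the Vandermonde convolution
`(M + k).choose k = ∑ z, M.choose z * k.choose z`. -/
theorem confluentHypergeometric_natCast_one {m : ℕ} (hm : 0 < m) (x : ℝ) :
    confluentHypergeometric m 1 x = exp x *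
      ∑ z ∈ Finset.range m, ((m - 1).choose z : ℝ) * x ^ z / (z.factorial : ℝ) := by
  obtain ⟨M, rfl⟩ : ∃ M, m = M + 1 := ⟨m - 1, by omega⟩
  have h1 : ∀ z : ℕ, HasSum (fun k : ℕ => (k.choose z : ℝ) * x ^ k / (k.factorial : ℝ))
      (exp x * (x ^ z / (z.factorial : ℝ))) := by
    intro z
    rw [← (add_left_injective z).hasSum_iff]
    · have h := (NormedSpace.expSeries_div_hasSum_exp x).mul_right (x ^ z / (z.factorial : ℝ))
      rw [← Real.exp_eq_exp_ℝ] at h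
      convert! h using 1
      funext j
      have hc := Nat.add_choose_mul_factorial_mul_factorial j z
      have hc' : ((j + z).choose z : ℝ) * (j.factorial : ℝ) * (z.factorial : ℝ) =
          ((j + z).factorial : ℝ) := by
        exact_mod_cast hc
      simp only [Function.comp_apply]
      rw [← hc']
      have := Nat.choose_pos (Nat.le_add_left z j)
      field_simp
      ring
    · intro k hk
      have : k < z := by
        by_contra! hkz
        exact hk ⟨k - z, by simp; omega⟩
      rw [Nat.choose_eq_zero_of_lt this]; simp
  have h2 : ∀ k : ℕ, (ascPochhammer ℝ k).eval ((M + 1 : ℕ) : ℝ) / (ascPochhammer ℝ k).eval 1 *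
      x ^ k / (k.factorial : ℝ) = ∑ z ∈ Finset.range (M + 1),
        (M.choose z : ℝ) * ((k.choose z : ℝ) * x ^ k / (k.factorial : ℝ)) := by
    intro k
    have ha : (ascPochhammer ℝ k).eval ((M + 1 : ℕ) : ℝ) =
        (k.factorial : ℝ) * ((M + k).choose k : ℝ) := by
      rw [← Nat.cast_ascFactorial, Nat.ascFactorial_eq_factorial_mul_choose]
      push_cast; ring
    have hv : (M + k).choose k = ∑ z ∈ Finset.range (M + 1), M.choose z * k.choose z := by
      rw [Nat.add_choose_eq, Finset.Nat.sum_antidiagonal_eq_sum_range_succ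
        (fun i j => M.choose i * k.choose j)]
      have e : ∀ n, n ≤ M + k → (∀ z, n < z → M.choose z * k.choose z = 0) →
          ∑ z ∈ Finset.range (n + 1), M.choose z * k.choose z =
            ∑ z ∈ Finset.range (M + k + 1), M.choose z * k.choose z := by
        intro n hn h0
        refine Finset.sum_subset (Finset.range_mono (by omega)) fun z _ hz => h0 z ?_
        simpa using hz
      rw [e M (by omega) (fun z hz => by rw [Nat.choose_eq_zero_of_lt hz, zero_mul]),
        ← e k (by omega) (fun z hz => by rw [Nat.choose_eq_zero_of_lt hz, mul_zero])]
      refine Finset.sum_congr rfl fun z hz => ?_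
      rw [Nat.choose_symm (by simpa [Nat.lt_succ_iff] using hz)]
    rw [ha, ascPochhammer_eval_one, hv]
    push_cast
    rw [mul_div_cancel_left₀ _ (by positivity), Finset.sum_mul, Finset.sum_div]
    refine Finset.sum_congr rfl fun z _ => by ring
  rw [confluentHypergeometric]
  simp_rw [h2]
  rw [(hasSum_sum fun z _ => (h1 z).mul_left (M.choose z : ℝ)).tsum_eq, Finset.mul_sum]
  refine Finset.sum_congr rfl fun z _ => ?_
  simp only [Nat.add_sub_cancel]
  ring

theorem neg_one_pow_mul_ascPochhammer_one_sub {m : ℕ} (hm : 0 < m) (z : ℕ) :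
    (-1) ^ z * (ascPochhammer ℝ z).eval (1 - (m : ℝ)) =
      (z.factorial : ℝ) * ((m - 1).choose z : ℝ) := by
  obtain ⟨M, rfl⟩ : ∃ M, m = M + 1 := ⟨m - 1, by omega⟩
  have : (1 - ((M + 1 : ℕ) : ℝ)) = -(M : ℝ) := by push_cast; ring
  rw [this, ascPochhammer_eval_neg_eq_descPochhammer, ← mul_assoc, ← mul_pow, neg_one_mul, neg_neg,
    one_pow, one_mul, descPochhammer_eval_eq_descFactorial, Nat.descFactorial_eq_factorial_mul_choose]
  push_cast; simp

/-- The derivative of the Poisson distribution function with respect to its mean. -/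
theorem hasDerivAt_sum_pow_mul_exp_neg (z : ℕ) (x : ℝ) :
    HasDerivAt (fun x : ℝ => (∑ v ∈ Finset.range (z + 1), x ^ v / (v.factorial : ℝ)) * exp (-x))
      (-(x ^ z / (z.factorial : ℝ) * exp (-x))) x := by
  have he : HasDerivAt (fun x : ℝ => exp (-x)) (exp (-x) * -1) x :=
    (Real.hasDerivAt_exp (-x)).comp x (hasDerivAt_neg x)
  induction z with
  | zero => simpa using he
  | succ z ih =>
    have h1 : HasDerivAt (fun x : ℝ => x ^ (z + 1) / ((z + 1).factorial : ℝ))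
        (x ^ z / (z.factorial : ℝ)) x := by
      refine ((hasDerivAt_pow (z + 1) x).div_const _).congr_deriv ?_
      rw [Nat.factorial_succ]; push_cast
      field_simp
    have h2 := ih.add (h1.mul he)
    refine (h2.congr_deriv (by ring)).congr_of_eventuallyEq (Filter.Eventually.of_forall fun y => ?_)
    simp only [Pi.add_apply, Pi.mul_apply]
    rw [Finset.sum_range_succ _ (z + 1), add_mul]

/-- The tail of the law of an Erlang variable, in terms of its square root. -/
theorem integral_Ioi_pow_mul_exp_neg_sq (z : ℕ) {a b : ℝ} (ha : 0 < a) (hb : 0 ≤ b) :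
    IntegrableOn (fun t : ℝ => 2 * t ^ (2 * z + 1) * exp (-(a * t ^ 2))) (Ioi b) ∧
    ∫ t in Ioi b, 2 * t ^ (2 * z + 1) * exp (-(a * t ^ 2)) =
      (z.factorial : ℝ) / a ^ (z + 1) *
        ((∑ v ∈ Finset.range (z + 1), (a * b ^ 2) ^ v / (v.factorial : ℝ)) *
          exp (-(a * b ^ 2))) := by
  set E : ℝ → ℝ := fun x => (∑ v ∈ Finset.range (z + 1), x ^ v / (v.factorial : ℝ)) * exp (-x)
    with hE
  set F : ℝ → ℝ := fun t => -((z.factorial : ℝ) / a ^ (z + 1)) * E (a * t ^ 2) with hF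
  have hd : ∀ t, HasDerivAt F (2 * t ^ (2 * z + 1) * exp (-(a * t ^ 2))) t := by
    intro t
    have h1 : HasDerivAt (fun t : ℝ => a * t ^ 2) (a * (2 * t)) t := by
      refine ((hasDerivAt_pow 2 t).const_mul a).congr_deriv ?_
      simp
    refine (((hasDerivAt_sum_pow_mul_exp_neg z (a * t ^ 2)).comp t h1).const_mul
      (-((z.factorial : ℝ) / a ^ (z + 1)))).congr_deriv ?_
    field_simp
    ring
  have hlim : Filter.Tendsto F Filter.atTop (nhds 0) := by
    have h1 : Filter.Tendsto E Filter.atTop (nhds 0) := by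
      have : E = fun x => ∑ v ∈ Finset.range (z + 1), (x ^ v * exp (-x)) / (v.factorial : ℝ) := by
        funext x
        rw [hE]; simp only
        rw [Finset.sum_mul]
        exact Finset.sum_congr rfl fun v _ => by ring
      rw [this, show (0 : ℝ) = ∑ v ∈ Finset.range (z + 1), 0 / (v.factorial : ℝ) by simp]
      exact tendsto_finsetSum _ fun v _ =>
        (Real.tendsto_pow_mul_exp_neg_atTop_nhds_zero v).div_const _
    have h2 : Filter.Tendsto (fun t : ℝ => a * t ^ 2) Filter.atTop Filter.atTop :=
      (Filter.tendsto_pow_atTop two_ne_zero).const_mul_atTop ha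
    rw [hF, show (0 : ℝ) = -((z.factorial : ℝ) / a ^ (z + 1)) * 0 by simp]
    exact (h1.comp h2).const_mul _
  have hnn : ∀ t ∈ Ioi b, 0 ≤ 2 * t ^ (2 * z + 1) * exp (-(a * t ^ 2)) := by
    intro t ht
    have : 0 ≤ t := hb.trans (le_of_lt ht)
    positivity
  refine ⟨integrableOn_Ioi_deriv_of_nonneg' (fun t _ => hd t) hnn hlim, ?_⟩
  rw [integral_Ioi_of_hasDerivAt_of_nonneg' (fun t _ => hd t) hnn hlim, hF]
  simp only [hE]
  ring

/-! ### Nakagami and Shadowed-Rician power gains -/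

/-- The law of a power gain whose amplitude has density `f`. -/
noncomputable def gainLaw (f : ℝ → ℝ) : Measure ℝ :=
  (volume.withDensity fun t => ENNReal.ofReal (f t)).map fun t => t ^ 2

theorem IsFading.map_eq_gainLaw {Ω : Type*} [MeasurableSpace Ω] {P : Measure Ω} {f : ℝ → ℝ}
    {H : ℕ → Ω → ℝ} (hH : IsFading P f H) (i : ℕ) : P.map (H i) = gainLaw f := by
  have hs : Measurable fun ω => √(H i ω) := (hH.measurable i).sqrt
  rw [gainLaw, ← (hH.law i).map_eq, Measure.map_map (by fun_prop) hs]
  congr 1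
  funext ω
  exact (Real.sq_sqrt (hH.nonneg i ω)).symm

/-- The hypothesis on `f` lets an explicit formula `g` replace the density on the half-line. -/
theorem lintegral_gainLaw {f g : ℝ → ℝ} (hg : Measurable g) (hf : f = (Ioi 0).indicator g)
    {φ : ℝ → ENNReal} (hφ : Measurable φ) :
    ∫⁻ h, φ h ∂gainLaw f = ∫⁻ t in Ioi 0, ENNReal.ofReal (g t) * φ (t ^ 2) := by
  have hfm : Measurable f := hf ▸ hg.indicator measurableSet_Ioi
  rw [gainLaw, lintegral_map hφ (by fun_prop),
    lintegral_withDensity_eq_lintegral_mul _ (by fun_prop) (by fun_prop),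
    ← lintegral_indicator measurableSet_Ioi]
  refine lintegral_congr fun t => ?_
  subst hf
  by_cases ht : (0 : ℝ) < t <;> simp [indicator, ht]

/-- The Laplace transform of a unit-mean Nakagami power gain. -/
theorem lintegral_exp_neg_nakagami {m s : ℝ} (hm : 0 < m) (hs : 0 ≤ s) :
    ∫⁻ h, ENNReal.ofReal (exp (-(s * h))) ∂gainLaw (nakagamiPDF m) =
      ENNReal.ofReal ((1 + s / m) ^ (-m)) := by
  have hms : 0 < m + s := by linarith
  set g : ℝ → ℝ := fun t => 2 * m ^ m / Gamma m * t ^ (2 * m - 1) * exp (-m * t ^ 2)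
  have hΓ := Real.Gamma_pos_of_pos hm
  rw [lintegral_gainLaw (g := g) (by fun_prop) (by funext t; simp [nakagamiPDF, indicator, g])
    (by fun_prop)]
  have h1 : ∀ t ∈ Ioi (0 : ℝ), ENNReal.ofReal (g t) * ENNReal.ofReal (exp (-(s * t ^ 2))) =
      ENNReal.ofReal (2 * m ^ m / Gamma m *
        (t ^ (2 * m - 1) * exp (-(m + s) * t ^ (2 : ℝ)))) := by
    intro t ht
    have ht : (0 : ℝ) < t := ht
    rw [← ENNReal.ofReal_mul (by positivity)]
    congr 1
    simp only [g]
    rw [mul_assoc, mul_assoc, ← Real.exp_add, Real.rpow_two]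
    congr 5; ring
  have hI := integral_rpow_mul_exp_neg_mul_rpow (p := 2) (q := 2 * m - 1) (b := m + s)
    two_pos (by linarith) hms
  rw [setLIntegral_congr_fun measurableSet_Ioi h1, ← ofReal_integral_eq_lintegral_ofReal,
    integral_const_mul, hI]
  · congr 1
    rw [show (2 * m - 1 + 1) / 2 = m by ring, show -(2 * m - 1 + 1) / 2 = -m by ring,
      show 1 + s / m = (m + s) / m by field_simp, Real.div_rpow hms.le hm.le,
      Real.rpow_neg hm.le]
    have := Real.rpow_pos_of_pos hm m
    field_simp
  · refine Integrable.const_mul ?_ _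
    refine not_imp_comm.1 (integral_undef) ?_
    rw [hI]
    have := Real.rpow_pos_of_pos hms (-(2 * m - 1 + 1) / 2)
    have := Real.Gamma_pos_of_pos (show 0 < (2 * m - 1 + 1) / 2 by linarith)
    positivity
  · filter_upwards [ae_restrict_mem measurableSet_Ioi] with t ht
    have ht : (0 : ℝ) < t := ht
    simp only [Pi.zero_apply]
    positivity

/-- Tail integrals of a mixture of Erlang laws, with weights `w`. The shift `k` is `0` for tail
probabilities and Laplace transforms, and `1` for the mean. -/
theorem setLIntegral_sum_pow_mul_exp_neg_sq {m : ℕ} {w : ℕ → ℝ} (hw : ∀ z, 0 ≤ w z) (k : ℕ)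
    {a b : ℝ} (ha : 0 < a) (hb : 0 ≤ b) :
    ∫⁻ t in Ioi b, ENNReal.ofReal
      (∑ z ∈ Finset.range m, w z * (2 * t ^ (2 * (z + k) + 1) * exp (-(a * t ^ 2)))) =
    ENNReal.ofReal (∑ z ∈ Finset.range m, w z * (((z + k).factorial : ℝ) / a ^ (z + k + 1) *
      ((∑ v ∈ Finset.range (z + k + 1), (a * b ^ 2) ^ v / (v.factorial : ℝ)) *
        exp (-(a * b ^ 2))))) := by
  have h := fun z => integral_Ioi_pow_mul_exp_neg_sq (z + k) ha hb
  have hi : ∀ z ∈ Finset.range m, IntegrableOn (fun t : ℝ =>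
      w z * (2 * t ^ (2 * (z + k) + 1) * exp (-(a * t ^ 2)))) (Ioi b) :=
    fun z _ => (h z).1.const_mul _
  rw [← ofReal_integral_eq_lintegral_ofReal (integrable_finsetSum _ hi),
    integral_finsetSum _ hi]
  · simp_rw [integral_const_mul, fun z => (h z).2]
  · filter_upwards [ae_restrict_mem measurableSet_Ioi] with t ht
    have ht : (0 : ℝ) < t := hb.trans_lt ht
    exact Finset.sum_nonneg fun z _ => mul_nonneg (hw z) (by positivity)

namespace NetworkParams

variable {p : NetworkParams}

/-- The law of a satellite power gain. -/
noncomputable def satelliteGainLaw (p : NetworkParams) : Measure ℝ :=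
  gainLaw (shadowedRicianPDF p.mS p.b p.Om)

theorem beta_sub_c_pos (hp : p.Valid) : 0 < p.beta - p.c := by
  have := hp.b_pos; have := hp.Om_nonneg
  have hm : (0 : ℝ) < p.mS := by exact_mod_cast hp.mS_pos
  have : p.beta - p.c = p.mS / (2 * p.b * p.mS + p.Om) := by
    rw [beta, c]; field_simp; ring
  rw [this]; positivity

theorem zeta_eq (hp : p.Valid) (z : ℕ) : p.zeta z =
    (2 * p.b * p.mS / (2 * p.b * p.mS + p.Om)) ^ p.mS * p.beta *
      (((p.mS - 1).choose z : ℝ) * p.c ^ z / (z.factorial : ℝ)) := by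
  have := neg_one_pow_mul_ascPochhammer_one_sub hp.mS_pos z
  rw [zeta, mul_assoc p.beta, this]
  field_simp

theorem zeta_nonneg (hp : p.Valid) (z : ℕ) : 0 ≤ p.zeta z := by
  have := hp.b_pos; have := hp.Om_nonneg
  have : 0 ≤ p.beta := by rw [beta]; positivity
  have : 0 ≤ p.c := by rw [c]; positivity
  rw [zeta_eq hp]; positivity

/-- By Kummer's transformation, the density of the satellite amplitude is a polynomial times a
Gaussian. -/
theorem shadowedRicianPDF_eq (hp : p.Valid) : shadowedRicianPDF p.mS p.b p.Om =
    (Ioi 0).indicator fun t => ∑ z ∈ Finset.range p.mS,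
      p.zeta z * (2 * t ^ (2 * z + 1) * exp (-((p.beta - p.c) * t ^ 2))) := by
  funext t
  rw [shadowedRicianPDF, indicator]
  simp only [mem_Ioi]
  refine if_congr Iff.rfl ?_ rfl
  rw [show p.Om * t ^ 2 / (2 * p.b * (2 * p.b * p.mS + p.Om)) = p.c * t ^ 2 by rw [c]; ring,
    confluentHypergeometric_natCast_one hp.mS_pos, ← mul_assoc, mul_assoc (_ * (t / p.b)),
    ← Real.exp_add, Finset.mul_sum, Real.rpow_natCast]
  refine Finset.sum_congr rfl fun z _ => ?_
  have hb := hp.b_pos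
  rw [zeta_eq hp, show -t ^ 2 / (2 * p.b) + p.c * t ^ 2 = -((p.beta - p.c) * t ^ 2) by
    rw [beta]; ring, beta, mul_pow, ← pow_mul]
  field_simp
  ring

theorem measurable_gain_density : Measurable fun t : ℝ => ∑ z ∈ Finset.range p.mS,
    p.zeta z * (2 * t ^ (2 * z + 1) * exp (-((p.beta - p.c) * t ^ 2))) := by
  fun_prop

theorem gain_density_nonneg (hp : p.Valid) {t : ℝ} (ht : 0 < t) : 0 ≤ ∑ z ∈ Finset.range p.mS,
    p.zeta z * (2 * t ^ (2 * z + 1) * exp (-((p.beta - p.c) * t ^ 2))) :=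
  Finset.sum_nonneg fun z _ => mul_nonneg (zeta_nonneg hp z) (by positivity)

/-- The Laplace transform of a satellite gain. -/
theorem lintegral_exp_neg_satelliteGain (hp : p.Valid) {s : ℝ} (hs : 0 ≤ s) :
    ∫⁻ h, ENNReal.ofReal (exp (-(s * h))) ∂p.satelliteGainLaw =
      ENNReal.ofReal (∑ z ∈ Finset.range p.mS,
        p.zeta z * Gamma (z + 1) / (p.beta - p.c + s) ^ (z + 1)) := by
  have hδ := beta_sub_c_pos hp
  rw [satelliteGainLaw, lintegral_gainLaw (measurable_gain_density) (shadowedRicianPDF_eq hp)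
    (by fun_prop)]
  have h := setLIntegral_sum_pow_mul_exp_neg_sq (m := p.mS) (zeta_nonneg hp) 0
    (add_pos_of_pos_of_nonneg hδ hs) le_rfl
  simp only [add_zero] at h
  refine (setLIntegral_congr_fun measurableSet_Ioi fun t ht => ?_).trans (h.trans ?_)
  · rw [← ENNReal.ofReal_mul (gain_density_nonneg hp ht), Finset.sum_mul]
    congr 1
    refine Finset.sum_congr rfl fun z _ => ?_
    rw [add_mul, neg_add, Real.exp_add]; ring
  · congr 1
    refine Finset.sum_congr rfl fun z _ => ?_
    rw [Finset.sum_eq_single 0 (by intro v _ hv; simp [hv]) (by simp), Gamma_nat_eq_factorial]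
    simp
    ring

/-- The complementary distribution function of a satellite gain: a polynomial times an
exponential. -/
theorem satelliteGainLaw_Ioi (hp : p.Valid) {y : ℝ} (hy : 0 ≤ y) :
    p.satelliteGainLaw (Ioi y) = ENNReal.ofReal (∑ z ∈ Finset.range p.mS,
      p.zeta z * Gamma (z + 1) / (p.beta - p.c) ^ (z + 1) *
        ∑ v ∈ Finset.range (z + 1), ((p.beta - p.c) * y) ^ v / (v.factorial : ℝ) *
          exp (-((p.beta - p.c) * y))) := by
  have hδ := beta_sub_c_pos hp
  rw [← lintegral_indicator_one measurableSet_Ioi, satelliteGainLaw,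
    lintegral_gainLaw (measurable_gain_density) (shadowedRicianPDF_eq hp)
    (measurable_one.indicator measurableSet_Ioi)]
  have h := setLIntegral_sum_pow_mul_exp_neg_sq (m := p.mS) (zeta_nonneg hp) 0
    hδ (Real.sqrt_nonneg y)
  simp only [add_zero, Real.sq_sqrt hy] at h
  trans ∫⁻ t in Ioi √y, ENNReal.ofReal (∑ z ∈ Finset.range p.mS,
      p.zeta z * (2 * t ^ (2 * z + 1) * exp (-((p.beta - p.c) * t ^ 2))))
  · rw [← lintegral_indicator measurableSet_Ioi, ← lintegral_indicator measurableSet_Ioi]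
    refine lintegral_congr fun t => ?_
    simp only [indicator, mem_Ioi, Pi.one_apply]
    by_cases ht : 0 < t
    · simp only [if_pos ht, ← Real.sqrt_lt' ht]
      split_ifs <;> simp
    · rw [if_neg ht, if_neg]
      exact fun h => ht ((Real.sqrt_nonneg y).trans_lt h)
  · rw [h]
    congr 1
    refine Finset.sum_congr rfl fun z _ => ?_
    rw [Gamma_nat_eq_factorial, ← Finset.sum_mul]
    ring

theorem lintegral_satelliteGain_lt_top (hp : p.Valid) :
    ∫⁻ h, ENNReal.ofReal h ∂p.satelliteGainLaw < ⊤ := by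
  have hδ := beta_sub_c_pos hp
  rw [satelliteGainLaw, lintegral_gainLaw (measurable_gain_density) (shadowedRicianPDF_eq hp)
    (by fun_prop)]
  have h := setLIntegral_sum_pow_mul_exp_neg_sq (m := p.mS) (zeta_nonneg hp) 1 hδ le_rfl
  refine ((setLIntegral_congr_fun measurableSet_Ioi fun t ht => ?_).trans h).trans_lt
    ENNReal.ofReal_lt_top
  rw [← ENNReal.ofReal_mul (gain_density_nonneg hp ht), Finset.sum_mul]
  congr 1
  refine Finset.sum_congr rfl fun z _ => ?_
  ring

end NetworkParams

/-! ### The Laplace functional of a spherical Poisson process -/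

/-- The intensity measure of a spherical Poisson process, in terms of the distance to a point at
height `a`. -/
theorem intensity_lintegral_dist {R a ρ lam : ℝ} (ha : 0 < a) (haR : a ≤ R) (hlam : 0 < lam)
    (hρ : ρ ≤ R + a) {A : Set Space3}
    (hA : ∀ᵐ x ∂sphereArea R, x ∈ A ↔ ‖x - !₂[0, 0, a]‖ ≤ ρ)
    {φ : ℝ → ENNReal} (hφ : Measurable φ) :
    ((lam * (sphereArea R).real univ).toNNReal : ENNReal) *
      ∫⁻ x, A.indicator (fun x => φ ‖x - !₂[0, 0, a]‖) x ∂sphereUniform R =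
      ∫⁻ v in Ioc (R - a) ρ, ENNReal.ofReal (2 * π * (lam * (R / a)) * v) * φ v := by
  rw [← smul_eq_mul, ← lintegral_smul_measure, ofReal_density_smul_sphereUniform
    (ha.trans_le haR) hlam, lintegral_smul_measure, lintegral_sphereArea_dist ha haR hρ hA hφ,
    smul_eq_mul, ← lintegral_const_mul _ (by fun_prop)]
  refine lintegral_congr fun v => ?_
  rw [← mul_assoc, ← ENNReal.ofReal_mul hlam.le]
  congr 2; ring

/-- Integrating out the mark first. -/
theorem lintegral_sphereUniform_prod {R a : ℝ} (hR : 0 < R) {A : Set Space3} (hA : MeasurableSet A)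
    {ρG : Measure ℝ} [IsProbabilityMeasure ρG] {q : ℝ → ℝ → ENNReal}
    (hq : Measurable (Function.uncurry q)) :
    ∫⁻ ξ, A.indicator (fun x => q ‖x - !₂[0, 0, a]‖ ξ.2) ξ.1 ∂(sphereUniform R).prod ρG =
      ∫⁻ x, A.indicator (fun x => ∫⁻ h, q ‖x - !₂[0, 0, a]‖ h ∂ρG) x ∂sphereUniform R := by
  have := isProbabilityMeasure_sphereUniform hR
  have hm : Measurable fun ξ : Space3 × ℝ => q ‖ξ.1 - !₂[0, 0, a]‖ ξ.2 :=
    hq.comp (((measurable_norm_sub _).comp measurable_fst).prodMk measurable_snd)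
  have hm' : Measurable fun ξ : Space3 × ℝ =>
      A.indicator (fun x => q ‖x - !₂[0, 0, a]‖ ξ.2) ξ.1 := by
    have : (fun ξ : Space3 × ℝ => A.indicator (fun x => q ‖x - !₂[0, 0, a]‖ ξ.2) ξ.1) =
        (Prod.fst ⁻¹' A).indicator fun ξ : Space3 × ℝ => q ‖ξ.1 - !₂[0, 0, a]‖ ξ.2 := by
      rfl
    rw [this]
    exact hm.indicator (measurable_fst hA)
  rw [lintegral_prod _ hm'.aemeasurable]
  refine lintegral_congr fun x => ?_
  by_cases hx : x ∈ A <;> simp [hx]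

open Classical in
/-- The Laplace functional of a spherical Poisson process of marked points: a point of `A` at
distance `v` with mark `h` contributes the factor `q v h`, of mean `M v`, to the product. -/
theorem lintegral_prod_sphere {Ω T : Type*} [MeasurableSpace Ω] [MeasurableSpace T]
    {P : Measure Ω} {R a ρ lam : ℝ} {τ : Measure T} [SFinite τ] {N : Ω → ℕ}
    {z : ℕ → Ω → Space3 × ℝ} {J : Ω → T} {ρG : Measure ℝ} [IsProbabilityMeasure ρG]
    (ha : 0 < a) (haR : a ≤ R) (hlam : 0 < lam)
    (h : IsPoissonWith P (lam * (sphereArea R).real univ).toNNReal ((sphereUniform R).prod ρG) τ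
      N z J)
    (hρ : R - a ≤ ρ) (hρ' : ρ ≤ R + a) {A : Set Space3} (hAm : MeasurableSet A)
    (hA : ∀ᵐ x ∂sphereArea R, x ∈ A ↔ ‖x - !₂[0, 0, a]‖ ≤ ρ)
    (hG : ∀ᵐ g ∂ρG, 0 ≤ g) {q : ℝ → ℝ → ENNReal} (hq : Measurable (Function.uncurry q))
    (hq1 : ∀ v g, 0 ≤ v → 0 ≤ g → q v g ≤ 1) {M : ℝ → ℝ}
    (hM : ∀ v ∈ Ioc (R - a) ρ, 0 ≤ M v ∧ ∫⁻ g, q v g ∂ρG = ENNReal.ofReal (M v))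
    {k : T → ENNReal} (hk : Measurable k) :
    ∫⁻ ω, (∏ i : Fin (N ω), if (z i ω).1 ∈ A then q ‖(z i ω).1 - !₂[0, 0, a]‖ (z i ω).2 else 1) *
      k (J ω) ∂P =
    ENNReal.ofReal (exp (-(2 * π * (lam * (R / a)) * ∫ v in (R - a)..ρ, (1 - M v) * v))) *
      ∫⁻ t, k t ∂τ := by
  have hR : 0 < R := ha.trans_le haR
  have := isProbabilityMeasure_sphereUniform hR
  set g : Space3 × ℝ → ENNReal := fun ξ => if ξ.1 ∈ A then q ‖ξ.1 - !₂[0, 0, a]‖ ξ.2 else 1 with hg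
  have hd : Measurable fun ξ : Space3 × ℝ => q ‖ξ.1 - !₂[0, 0, a]‖ ξ.2 :=
    hq.comp (((measurable_norm_sub _).comp measurable_fst).prodMk measurable_snd)
  have hgm : Measurable g := Measurable.ite (measurable_fst hAm) hd measurable_const
  have hg1 : g ≤ᵐ[(sphereUniform R).prod ρG] fun _ => 1 := by
    filter_upwards [Measure.quasiMeasurePreserving_snd.ae hG] with ξ hξ
    simp only [hg]
    split_ifs
    · exact hq1 _ _ (norm_nonneg _) hξ
    · exact le_rfl
  have hone : ∫⁻ ξ, (1 : ENNReal) ∂(sphereUniform R).prod ρG = 1 := by simp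
  have hgle : ∫⁻ ξ, g ξ ∂(sphereUniform R).prod ρG ≤ 1 := (lintegral_mono_ae hg1).trans_eq hone
  have hgt : ∫⁻ ξ, g ξ ∂(sphereUniform R).prod ρG ≠ ⊤ :=
    ne_top_of_le_ne_top ENNReal.one_ne_top hgle
  refine (h.lintegral_prod_mul hgm hgt hk).trans ?_
  congr 4
  -- it remains to compute the mean of `1 - g` against the intensity measure
  have hq' : Measurable (Function.uncurry fun v g => 1 - q v g) := measurable_const.sub hq
  have h1 : 1 - ∫⁻ ξ, g ξ ∂(sphereUniform R).prod ρG =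
      ∫⁻ x, A.indicator (fun x => ∫⁻ g, (1 - q ‖x - !₂[0, 0, a]‖ g) ∂ρG) x ∂sphereUniform R := by
    rw [← lintegral_sphereUniform_prod hR hAm hq', ← hone, ← lintegral_sub hgm hgt hg1]
    refine lintegral_congr fun ξ => ?_
    by_cases hξ : ξ.1 ∈ A <;> simp [hg, hξ]
  have hnn : ∀ v ∈ Ioc (R - a) ρ, 0 ≤ v := fun v hv => (sub_nonneg.2 haR).trans hv.1.le
  have hM1 : ∀ v ∈ Ioc (R - a) ρ, M v ≤ 1 := by
    intro v hv
    rw [← ENNReal.ofReal_le_one, ← (hM v hv).2]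
    refine (lintegral_mono_ae (g := fun _ => 1) ?_).trans_eq (by simp)
    filter_upwards [hG] with g hg using hq1 v g (hnn v hv) hg
  have h2 := intensity_lintegral_dist ha haR hlam hρ' hA (φ := fun v => ∫⁻ g, (1 - q v g) ∂ρG)
    hq'.lintegral_prod_right'
  rw [← h1] at h2
  have hI : Measurable fun v => ∫⁻ g, q v g ∂ρG := hq.lintegral_prod_right'
  have h3 : ∫⁻ v in Ioc (R - a) ρ, ENNReal.ofReal (2 * π * (lam * (R / a)) * v) *
      ∫⁻ g, (1 - q v g) ∂ρG =
      ∫⁻ v in Ioc (R - a) ρ, ENNReal.ofReal (2 * π * (lam * (R / a)) * ((1 - M v) * v)) := by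
    refine setLIntegral_congr_fun measurableSet_Ioc fun v hv => ?_
    have hqv : Measurable (q v) := hq.comp measurable_prodMk_left
    have hv0 := hnn v hv
    rw [lintegral_sub hqv (by rw [(hM v hv).2]; finiteness)
      (by filter_upwards [hG] with g hg using hq1 v g hv0 hg), (hM v hv).2,
      lintegral_one, measure_univ, ← ENNReal.ofReal_one, ← ENNReal.ofReal_sub _ (hM v hv).1,
      ← ENNReal.ofReal_mul (by positivity)]
    congr 1; ring
  have h4 : ((lam * (sphereArea R).real univ).toNNReal : ℝ) *
      (1 - (∫⁻ ξ, g ξ ∂(sphereUniform R).prod ρG).toReal) =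
      (((lam * (sphereArea R).real univ).toNNReal : ENNReal) *
        (1 - ∫⁻ ξ, g ξ ∂(sphereUniform R).prod ρG)).toReal := by
    rw [ENNReal.toReal_mul, ENNReal.toReal_sub_of_le hgle ENNReal.one_ne_top]
    simp
  rw [h4, h2, h3, intervalIntegral.integral_of_le hρ, ← integral_const_mul,
    integral_eq_lintegral_of_nonneg_ae]
  · filter_upwards [ae_restrict_mem measurableSet_Ioc] with v hv
    have := hnn v hv
    have := sub_nonneg.2 (hM1 v hv)
    simp only [Pi.zero_apply]
    positivity
  · have : Measurable fun v => 2 * π * (lam * (R / a)) * ((1 - (∫⁻ g, q v g ∂ρG).toReal) * v) := by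
      fun_prop
    refine this.aestronglyMeasurable.congr ?_
    filter_upwards [ae_restrict_mem measurableSet_Ioc] with v hv
    rw [(hM v hv).2, ENNReal.toReal_ofReal (hM v hv).1]

theorem ae_nonneg_gainLaw (f : ℝ → ℝ) : ∀ᵐ h ∂gainLaw f, 0 ≤ h := by
  exact (ae_map_iff (by fun_prop) measurableSet_Ici).2 (ae_of_all _ fun t => sq_nonneg t)

/-! ### The SINR as a sum over the satellites -/

namespace NetworkParams

variable (p : NetworkParams)

/-- Interference power caused by a satellite at position `ξ.1` with gain `ξ.2`, which is `0` if the
satellite is not visible. -/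
noncomputable def satelliteWeight (ξ : Space3 × ℝ) : ℝ :=
  (p.visibleCap p.RS).indicator
    (fun x => p.gainSatellite * p.PS * ξ.2 * ‖x - p.user‖ ^ (-p.alphaS)) ξ.1

/-- Interference power caused by a terrestrial node at position `ξ.1` with gain `ξ.2`, which is `0`
if the node is not visible. -/
noncomputable def terrestrialWeight (o : TerrestrialLink) (ξ : Space3 × ℝ) : ℝ :=
  (p.visibleTerrestrial o).indicator
    (fun x => p.gainTerrestrial o * p.powerTerrestrial o * ξ.2 * ‖x - p.user‖ ^ (-p.alphaT)) ξ.1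

/-- Interference plus noise power, for satellites `z` that all interfere and terrestrial
interference `t`. -/
noncomputable def interference (n : ℕ) (y : (Fin n → Space3 × ℝ) × ℝ) : ℝ :=
  (∑ j, p.satelliteWeight (y.1 j)) + y.2 + p.noise

/-- No visible satellite of the configuration `z` is at distance at most `r`. -/
def NoneWithin (r : ℝ) (n : ℕ) (z : Fin n → Space3 × ℝ) : Prop :=
  ∀ j, (z j).1 ∈ p.visibleCap p.RS → r < ‖(z j).1 - p.user‖

open Classical in
/-- The value `F SINR` if the satellite `ξ` serves the user in presence of the other satellites and
of the terrestrial interference `y`, and `0` if it does not. -/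
noncomputable def servingTerm {M : Type*} [Zero M] (F : ℝ → M) (n : ℕ) (ξ : Space3 × ℝ)
    (y : (Fin n → Space3 × ℝ) × ℝ) : M :=
  if ξ.1 ∈ p.visibleCap p.RS ∧ p.NoneWithin ‖ξ.1 - p.user‖ n y.1 then
    F (p.gainServing * p.PS * ξ.2 * ‖ξ.1 - p.user‖ ^ (-p.alphaS) / p.interference n y)
  else 0

/-- The sum of `servingTerm` over all satellites of a configuration. -/
noncomputable def servingSum {M : Type*} [AddCommMonoid M] (F : ℝ → M) :
    ∀ n : ℕ, (Fin n → Space3 × ℝ) × ℝ → M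
  | 0, _ => 0
  | n + 1, y => ∑ i, p.servingTerm F n (y.1 i) (fun j => y.1 (i.succAbove j), y.2)

theorem measurable_satelliteWeight : Measurable p.satelliteWeight := by
  have : p.satelliteWeight = (Prod.fst ⁻¹' p.visibleCap p.RS).indicator fun ξ : Space3 × ℝ =>
      p.gainSatellite * p.PS * ξ.2 * ‖ξ.1 - p.user‖ ^ (-p.alphaS) := rfl
  rw [this]
  refine Measurable.indicator ?_ (measurable_fst (p.measurableSet_visibleCap _))
  fun_prop

theorem measurable_interference (n : ℕ) : Measurable (p.interference n) := by
  have := p.measurable_satelliteWeight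
  unfold interference
  fun_prop

theorem measurableSet_noneWithin (n : ℕ) :
    MeasurableSet {y : ℝ × (Fin n → Space3 × ℝ) | p.NoneWithin y.1 n y.2} := by
  simp only [NoneWithin, ofPred_forall]
  refine MeasurableSet.iInter fun j => ?_
  have h1 : MeasurableSet {y : ℝ × (Fin n → Space3 × ℝ) | (y.2 j).1 ∈ p.visibleCap p.RS} :=
    (show Measurable fun y : ℝ × (Fin n → Space3 × ℝ) => (y.2 j).1 by fun_prop)
      (p.measurableSet_visibleCap _)
  have h2 : MeasurableSet {y : ℝ × (Fin n → Space3 × ℝ) | y.1 < ‖(y.2 j).1 - p.user‖} :=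
    measurableSet_lt (by fun_prop) (by fun_prop)
  convert! h1.compl.union h2 using 1
  ext y
  simp [imp_iff_not_or]

theorem measurable_servingTerm {M : Type*} [Zero M] [MeasurableSpace M] {F : ℝ → M}
    (hF : Measurable F) (n : ℕ) : Measurable (Function.uncurry (p.servingTerm F n)) := by
  classical
  have h1 := p.measurable_interference n
  have h2 : MeasurableSet {a : (Space3 × ℝ) × ((Fin n → Space3 × ℝ) × ℝ) |
      a.1.1 ∈ p.visibleCap p.RS ∧ p.NoneWithin ‖a.1.1 - p.user‖ n a.2.1} :=
    MeasurableSet.inter (measurable_fst.comp measurable_fst (p.measurableSet_visibleCap _))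
      ((show Measurable fun a : (Space3 × ℝ) × ((Fin n → Space3 × ℝ) × ℝ) =>
        (‖a.1.1 - p.user‖, a.2.1) by fun_prop) (p.measurableSet_noneWithin n))
  refine Measurable.ite h2 (hF.comp ?_) measurable_const
  fun_prop

theorem measurable_servingSum {M : Type*} [AddCommMonoid M] [MeasurableSpace M]
    [MeasurableAdd₂ M] {F : ℝ → M} (hF : Measurable F) (n : ℕ) :
    Measurable (p.servingSum F n) := by
  cases n with
  | zero => exact measurable_const
  | succ n =>
    change Measurable fun y : (Fin (n + 1) → Space3 × ℝ) × ℝ =>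
      ∑ i, p.servingTerm F n (y.1 i) (fun j => y.1 (i.succAbove j), y.2)
    refine Finset.measurable_sum _ fun i _ => ?_
    have hm : Measurable fun y : (Fin (n + 1) → Space3 × ℝ) × ℝ =>
        (y.1 i, ((fun j => y.1 (i.succAbove j)), y.2)) := by fun_prop
    have h1 : Measurable (Function.uncurry (p.servingTerm F n)) := p.measurable_servingTerm hF n
    have h2 := h1.comp hm
    exact h2

/-- If no two satellites are equally far from the user, then at most one satellite contributes to
`servingSum`, namely the serving one. -/
theorem comp_sinr_eq_servingSum {M : Type*} [AddCommMonoid M] {F : ℝ → M} (hF : F 0 = 0)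
    (o : TerrestrialLink) (n : ℕ) (x : ℕ → Space3) (h : ℕ → ℝ) (k : ℕ) (y : ℕ → Space3)
    (g : ℕ → ℝ)
    (hne : ∀ i < n, ∀ j < n, i ≠ j → ‖x i - p.user‖ ≠ ‖x j - p.user‖) :
    F (p.sinr o n x h k y g) = p.servingSum F n (fun i => (x i, h i),
      ∑ i : Fin k, p.terrestrialWeight o (y i, g i)) := by
  classical
  set V := visibleIndices (p.visibleCap p.RS) n x with hV
  have hmem : ∀ i, i ∈ V ↔ i < n ∧ x i ∈ p.visibleCap p.RS := fun i => by
    simp [hV, visibleIndices]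
  have hT : ∑ i ∈ visibleIndices (p.visibleTerrestrial o) k y,
      p.gainTerrestrial o * p.powerTerrestrial o * g i * ‖y i - p.user‖ ^ (-p.alphaT) =
      ∑ i : Fin k, p.terrestrialWeight o (y i, g i) := by
    rw [visibleIndices, Finset.sum_filter,
      ← Fin.sum_univ_eq_sum_range (fun i => if y i ∈ p.visibleTerrestrial o then
        p.gainTerrestrial o * p.powerTerrestrial o * g i * ‖y i - p.user‖ ^ (-p.alphaT) else 0)]
    rfl
  by_cases hne' : V.Nonempty
  swap
  · have h0 : p.sinr o n x h k y g = 0 := by rw [sinr, if_neg hne']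
    rw [h0, hF]
    cases n with
    | zero => rfl
    | succ n =>
      refine (Finset.sum_eq_zero fun i _ => ?_).symm
      rw [servingTerm, if_neg]
      exact fun hi => hne' ⟨i, (hmem i).2 ⟨i.2, hi.1⟩⟩
  obtain ⟨n, rfl⟩ : ∃ m, n = m + 1 := by
    obtain ⟨i, hi⟩ := hne'
    exact ⟨n - 1, by have := ((hmem i).1 hi).1; omega⟩
  obtain ⟨i₀, hi₀, hmin₀⟩ := V.exists_min_image (fun i => ‖x i - p.user‖) hne'
  have hs : p.servingIndex (n + 1) x ∈ {i | i ∈ V ∧ ∀ j ∈ V, ‖x i - p.user‖ ≤ ‖x j - p.user‖} :=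
    Nat.sInf_mem ⟨i₀, hi₀, hmin₀⟩
  set s := p.servingIndex (n + 1) x with hsdef
  obtain ⟨hsV, hsmin⟩ := hs
  obtain ⟨hsn, hsvis⟩ := (hmem s).1 hsV
  have hI : (∑ i ∈ V.erase s, p.gainSatellite * p.PS * h i * ‖x i - p.user‖ ^ (-p.alphaS)) =
      ∑ j : Fin n, p.satelliteWeight
        (x ((⟨s, hsn⟩ : Fin (n + 1)).succAbove j), h ((⟨s, hsn⟩ : Fin (n + 1)).succAbove j)) := by
    have h1 : (∑ i ∈ V, p.gainSatellite * p.PS * h i * ‖x i - p.user‖ ^ (-p.alphaS)) =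
        ∑ i : Fin (n + 1), p.satelliteWeight (x i, h i) := by
      rw [hV, visibleIndices, Finset.sum_filter,
        ← Fin.sum_univ_eq_sum_range (fun i => if x i ∈ p.visibleCap p.RS then
          p.gainSatellite * p.PS * h i * ‖x i - p.user‖ ^ (-p.alphaS) else 0)]
      rfl
    rw [Fin.sum_univ_succAbove _ ⟨s, hsn⟩, ← Finset.add_sum_erase V _ hsV] at h1
    have h2 : p.satelliteWeight (x s, h s) =
        p.gainSatellite * p.PS * h s * ‖x s - p.user‖ ^ (-p.alphaS) := by
      rw [satelliteWeight, indicator_of_mem hsvis]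
    simp only [h2] at h1
    exact add_left_cancel h1
  have hsinr : p.sinr o (n + 1) x h k y g = p.gainServing * p.PS * h s *
      ‖x s - p.user‖ ^ (-p.alphaS) / p.interference n
        (fun j => (x ((⟨s, hsn⟩ : Fin (n + 1)).succAbove j),
          h ((⟨s, hsn⟩ : Fin (n + 1)).succAbove j)),
          ∑ i : Fin k, p.terrestrialWeight o (y i, g i)) := by
    rw [sinr, if_pos hne', interference, ← hI, ← hT]
  rw [hsinr, servingSum, Finset.sum_eq_single (⟨s, hsn⟩ : Fin (n + 1))]
  · rw [servingTerm, if_pos]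
    refine ⟨hsvis, fun j hj => ?_⟩
    set j' := (⟨s, hsn⟩ : Fin (n + 1)).succAbove j with hj'
    have hjs : s ≠ (j' : ℕ) := fun e =>
      (Fin.succAbove_ne (⟨s, hsn⟩ : Fin (n + 1)) j) (Fin.ext e.symm)
    exact lt_of_le_of_ne (hsmin j' ((hmem _).2 ⟨j'.2, hj⟩)) (hne s hsn j' j'.2 hjs)
  · intro i _ his
    rw [servingTerm, if_neg]
    rintro ⟨hi, hi'⟩
    obtain ⟨j, hj⟩ := Fin.exists_succAbove_eq (x := ⟨s, hsn⟩) (y := i) his.symm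
    have h1 := hi' j
    simp only [hj] at h1
    exact absurd (h1 hsvis) (not_lt.2 (hsmin i ((hmem _).2 ⟨i.2, hi⟩)))
  · simp

end NetworkParams

/-! ### The Mecke formula for the SINR -/

namespace NetworkParams

section

variable (p : NetworkParams) {Ω : Type*} (N : Ω → ℕ) (z : ℕ → Ω → Space3 × ℝ) (J : Ω → ℝ)

/-- The event that no visible satellite is at distance at most `r`. -/
def emptyEvent (r : ℝ) : Set Ω := {ω | p.NoneWithin r (N ω) fun i => z i ω}

/-- Interference plus noise power when all visible satellites interfere. -/
noncomputable def totalInterference (ω : Ω) : ℝ := p.interference (N ω) (fun i => z i ω, J ω)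

end

theorem freeSpace_pos {p : NetworkParams} (hp : p.Valid) : 0 < p.freeSpace := by
  have := hp.lightSpeed_pos; have := hp.fc_pos
  rw [freeSpace]; positivity

theorem gainServing_pos {p : NetworkParams} (hp : p.Valid) : 0 < p.gainServing :=
  mul_pos (mul_pos hp.GUmain_pos hp.GSmain_pos) (freeSpace_pos hp)

theorem gainSatellite_pos {p : NetworkParams} (hp : p.Valid) : 0 < p.gainSatellite :=
  mul_pos (mul_pos hp.GUside_pos hp.GSside_pos) (freeSpace_pos hp)

theorem gainTerrestrial_pos {p : NetworkParams} (hp : p.Valid) (o : TerrestrialLink) :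
    0 < p.gainTerrestrial o := by
  cases o
  · exact mul_pos (mul_pos hp.GUside_pos hp.GBside_pos) (freeSpace_pos hp)
  · exact mul_pos (mul_pos hp.GUside_pos hp.GTside_pos) (freeSpace_pos hp)

theorem powerTerrestrial_pos {p : NetworkParams} (hp : p.Valid) (o : TerrestrialLink) :
    0 < p.powerTerrestrial o := by
  cases o
  exacts [hp.PB_pos, hp.PT_pos]

theorem planarDensity_pos {p : NetworkParams} (hp : p.Valid) :
    0 < p.planarDensity p.lamS p.RS :=
  mul_pos hp.lamS_pos (div_pos (hp.RU_pos.trans hp.RU_lt_RS) hp.RU_pos)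

theorem Rmin_pos {p : NetworkParams} (hp : p.Valid) : 0 < p.Rmin p.RS := sub_pos.2 hp.RU_lt_RS

theorem Rmin_lt_Rmax_RS {p : NetworkParams} (hp : p.Valid) : p.Rmin p.RS < p.Rmax p.RS :=
  p.Rmin_lt_Rmax hp.RU_pos hp.RU_lt_RS hp.theta_gt hp.theta_lt

theorem ae_mem_visibleCap_iff {p : NetworkParams} (hU : 0 < p.RU) {R : ℝ} (hR : p.RU < R) :
    ∀ᵐ x ∂sphereArea R, x ∈ p.visibleCap R ↔ ‖x - !₂[0, 0, p.RU]‖ ≤ p.Rmax R := by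
  filter_upwards [ae_norm_sphereArea (hU.trans hR).le] with x hx
    using p.mem_visibleCap_iff hU hR hx

variable {p : NetworkParams} {Ω : Type*} [MeasurableSpace Ω] {P : Measure Ω}
  {τ : Measure ℝ} {N : Ω → ℕ} {z : ℕ → Ω → Space3 × ℝ} {J : Ω → ℝ}

theorem measurable_totalInterference {lam : NNReal} {ρ : Measure (Space3 × ℝ)}
    (h : IsPoissonWith P lam ρ τ N z J) : Measurable (p.totalInterference N z J) :=
  h.measurable_comp p.measurable_interference

/-- Joint measurability, in the radius and the outcome. -/
theorem measurableSet_emptyEvent_prod {lam : NNReal} {ρ : Measure (Space3 × ℝ)}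
    (h : IsPoissonWith P lam ρ τ N z J) :
    MeasurableSet {a : ℝ × Ω | a.2 ∈ p.emptyEvent N z a.1} := by
  have := h.measurable_comp_prod (S := ℝ) (β := Prop)
    (Φ := fun n r y => p.NoneWithin r n y.1) fun n => by
      refine measurableSet_setOfPred.1 ?_
      exact (show Measurable fun a : ℝ × ((Fin n → Space3 × ℝ) × ℝ) => (a.1, a.2.1) by fun_prop)
        (p.measurableSet_noneWithin n)
  exact measurableSet_setOfPred.2 this

theorem measurableSet_emptyEvent {lam : NNReal} {ρ : Measure (Space3 × ℝ)}
    (h : IsPoissonWith P lam ρ τ N z J) (r : ℝ) : MeasurableSet (p.emptyEvent N z r) :=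
  measurable_prodMk_left (measurableSet_emptyEvent_prod h)

/-- The mean of `F SINR` given that the serving satellite has distance `v` and gain `h`, restricted
to the event that no other satellite is nearer. -/
noncomputable def meanAt (p : NetworkParams) (P : Measure Ω) (N : Ω → ℕ)
    (z : ℕ → Ω → Space3 × ℝ) (J : Ω → ℝ) (F : ℝ → ENNReal) (v h : ℝ) : ENNReal :=
  ∫⁻ ω, (p.emptyEvent N z v).indicator (fun ω => F (p.gainServing * p.PS * h * v ^ (-p.alphaS) /
    p.totalInterference N z J ω)) ω ∂P

theorem measurable_meanAt_integrand {lam : NNReal} {ρ : Measure (Space3 × ℝ)}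
    (h : IsPoissonWith P lam ρ τ N z J) {F : ℝ → ENNReal} (hF : Measurable F) :
    Measurable fun a : (ℝ × ℝ) × Ω => (p.emptyEvent N z a.1.1).indicator (fun ω =>
      F (p.gainServing * p.PS * a.1.2 * a.1.1 ^ (-p.alphaS) / p.totalInterference N z J ω)) a.2 := by
  have h1 := measurable_totalInterference (p := p) h
  have h2 : Measurable fun a : (ℝ × ℝ) × Ω =>
      F (p.gainServing * p.PS * a.1.2 * a.1.1 ^ (-p.alphaS) / p.totalInterference N z J a.2) :=
    hF.comp (by fun_prop)
  exact h2.indicator ((show Measurable fun a : (ℝ × ℝ) × Ω => (a.1.1, a.2) by fun_prop)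
    (measurableSet_emptyEvent_prod (p := p) h))

theorem measurable_meanAt [SFinite P] {lam : NNReal} {ρ : Measure (Space3 × ℝ)}
    (h : IsPoissonWith P lam ρ τ N z J) {F : ℝ → ENNReal} (hF : Measurable F) :
    Measurable (Function.uncurry (p.meanAt P N z J F)) :=
  (measurable_meanAt_integrand h hF).lintegral_prod_right'

/-- The law of the SINR by the Mecke formula: the serving satellite is integrated over its distance
`v`, the other satellites form an independent copy of the process. -/
theorem lintegral_servingSum [SFinite P] [SFinite τ] (hp : p.Valid)
    [IsProbabilityMeasure p.satelliteGainLaw]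
    (h : IsPoissonWith P (p.lamS * (sphereArea p.RS).real univ).toNNReal
      ((sphereUniform p.RS).prod p.satelliteGainLaw) τ N z J)
    {F : ℝ → ENNReal} (hF : Measurable F) :
    ∫⁻ ω, p.servingSum F (N ω) (fun i => z i ω, J ω) ∂P =
      ∫⁻ v in Ioc (p.Rmin p.RS) (p.Rmax p.RS),
        ENNReal.ofReal (2 * π * p.planarDensity p.lamS p.RS * v) *
          ∫⁻ g, p.meanAt P N z J F v g ∂p.satelliteGainLaw := by
  have hR : 0 < p.RS := hp.RU_pos.trans hp.RU_lt_RS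
  have := isProbabilityMeasure_sphereUniform hR
  classical
  rw [h.mecke (Φ := p.servingSum F) (Ψ := p.servingTerm F)
    (fun n => p.measurable_servingTerm hF n) (fun _ => rfl) (fun _ _ => rfl)]
  have h1 : ∀ ξ : Space3 × ℝ,
      ∫⁻ ω, p.servingTerm F (N ω) ξ (fun i => z i ω, J ω) ∂P =
      (p.visibleCap p.RS).indicator (fun x => p.meanAt P N z J F ‖x - !₂[0, 0, p.RU]‖ ξ.2) ξ.1 := by
    intro ξ
    by_cases hξ : ξ.1 ∈ p.visibleCap p.RS
    · rw [indicator_of_mem hξ, meanAt]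
      refine lintegral_congr fun ω => ?_
      rw [servingTerm, indicator]
      exact if_congr (and_iff_right hξ) rfl rfl
    · simp [servingTerm, hξ]
  simp_rw [h1]
  rw [lintegral_sphereUniform_prod hR (p.measurableSet_visibleCap _) (measurable_meanAt h hF),
    intensity_lintegral_dist hp.RU_pos hp.RU_lt_RS.le hp.lamS_pos
      (p.Rmax_le hp.RU_pos hp.RU_lt_RS) (ae_mem_visibleCap_iff hp.RU_pos hp.RU_lt_RS)
      (φ := fun v => ∫⁻ g, p.meanAt P N z J F v g ∂p.satelliteGainLaw)
      (measurable_meanAt h hF).lintegral_prod_right']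
  rfl

end NetworkParams

/-! ### Laplace transforms of the interference -/

namespace NetworkParams

variable {p : NetworkParams} {Ω : Type*} [MeasurableSpace Ω] {P : Measure Ω}
  {τ : Measure ℝ} {N : Ω → ℕ} {z : ℕ → Ω → Space3 × ℝ} {J : Ω → ℝ}

theorem satelliteGainLaw_ae_nonneg : ∀ᵐ h ∂p.satelliteGainLaw, 0 ≤ h := ae_nonneg_gainLaw _

/-- The satellites nearer than `r` contribute the exponent of the probability that there are none,
the other ones contribute `satelliteExponent`. -/
theorem satelliteExponent_eq_of_mem (hp : p.Valid) {r s : ℝ} (hs : 0 ≤ s)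
    (hr : r ∈ Icc (p.Rmin p.RS) (p.Rmax p.RS)) :
    2 * π * p.planarDensity p.lamS p.RS * (∫ v in (p.Rmin p.RS)..(p.Rmax p.RS),
      (1 - if r < v then ∑ z ∈ Finset.range p.mS, p.zeta z * Gamma (z + 1) /
        (p.beta - p.c + s * p.gainSatellite * p.PS * v ^ (-p.alphaS)) ^ (z + 1) else 0) * v) =
    p.planarDensity p.lamS p.RS * π * (r ^ 2 - p.Rmin p.RS ^ 2) + p.satelliteExponent r s := by
  have hpos := Rmin_pos hp
  have hδ := beta_sub_c_pos hp
  have hG := gainSatellite_pos hp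
  have hPS := hp.PS_pos
  set f : ℝ → ℝ := fun v => ∑ z ∈ Finset.range p.mS, p.zeta z * Gamma (z + 1) /
    (p.beta - p.c + s * p.gainSatellite * p.PS * v ^ (-p.alphaS)) ^ (z + 1)
  have e1 : EqOn (fun v => (1 - if r < v then f v else 0) * v) (fun v => v)
      (uIoc (p.Rmin p.RS) r) := by
    intro v hv
    rw [uIoc_of_le hr.1] at hv
    simp [not_lt.2 hv.2]
  have e2 : EqOn (fun v => (1 - if r < v then f v else 0) * v) (fun v => (1 - f v) * v)
      (uIoc r (p.Rmax p.RS)) := by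
    intro v hv
    rw [uIoc_of_le hr.2] at hv
    simp [hv.1]
  have hc : ContinuousOn (fun v => (1 - f v) * v) (uIcc r (p.Rmax p.RS)) := by
    have hv0 : ∀ v ∈ uIcc r (p.Rmax p.RS), 0 < v := fun v hv => by
      rw [uIcc_of_le hr.2] at hv; exact hpos.trans_le (hr.1.trans hv.1)
    have hrp : ContinuousOn (fun v : ℝ => v ^ (-p.alphaS)) (uIcc r (p.Rmax p.RS)) :=
      fun v hv => (Real.continuousAt_rpow_const v _ (Or.inl (hv0 v hv).ne')).continuousWithinAt
    refine (continuousOn_const.sub (continuousOn_finsetSum _ fun z _ => ?_)).mul continuousOn_id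
    refine continuousOn_const.div ((continuousOn_const.add (continuousOn_const.mul hrp)).pow _) ?_
    intro v hv
    have := Real.rpow_nonneg (hv0 v hv).le (-p.alphaS)
    positivity
  have i1 : IntervalIntegrable (fun v => (1 - if r < v then f v else 0) * v) volume
      (p.Rmin p.RS) r :=
    (intervalIntegrable_congr e1).2 (Continuous.intervalIntegrable continuous_id _ _)
  have i2 : IntervalIntegrable (fun v => (1 - if r < v then f v else 0) * v) volume
      r (p.Rmax p.RS) :=
    (intervalIntegrable_congr e2).2 hc.intervalIntegrable
  rw [← intervalIntegral.integral_add_adjacent_intervals i1 i2,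
    intervalIntegral.integral_congr_ae (ae_of_all _ e1),
    intervalIntegral.integral_congr_ae (ae_of_all _ e2), integral_id,
    satelliteExponent]
  ring

/-- The Laplace transform of the interference power on the event that no satellite is nearer than
`r`: the Laplace functional of the satellite process, in which the satellites nearer than `r`
contribute the factor `0`. -/
theorem setLIntegral_exp_neg_totalInterference [SFinite τ] (hp : p.Valid)
    [IsProbabilityMeasure p.satelliteGainLaw]
    (h : IsPoissonWith P (p.lamS * (sphereArea p.RS).real univ).toNNReal
      ((sphereUniform p.RS).prod p.satelliteGainLaw) τ N z J) {o : TerrestrialLink}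
    (hτ : ∀ s, 0 ≤ s → ∫⁻ t, ENNReal.ofReal (exp (-(s * t))) ∂τ =
      ENNReal.ofReal (exp (-p.terrestrialExponent o s)))
    {r s : ℝ} (hs : 0 ≤ s) (hr : r ∈ Icc (p.Rmin p.RS) (p.Rmax p.RS)) :
    ∫⁻ ω in p.emptyEvent N z r, ENNReal.ofReal (exp (-(s * p.totalInterference N z J ω))) ∂P =
      ENNReal.ofReal (exp (-(p.planarDensity p.lamS p.RS * π * (r ^ 2 - p.Rmin p.RS ^ 2))) *
        p.laplaceInterference o r s) := by
  classical
  have hδ := beta_sub_c_pos hp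
  have hG := gainSatellite_pos hp
  have hPS := hp.PS_pos
  set q : ℝ → ℝ → ENNReal := fun v h => if r < v then ENNReal.ofReal
    (exp (-(s * (p.gainSatellite * p.PS * h * v ^ (-p.alphaS))))) else 0 with hq
  have hqm : Measurable (Function.uncurry q) :=
    Measurable.ite (measurableSet_lt measurable_const measurable_fst) (by fun_prop)
      measurable_const
  have hrR : ∀ v ∈ Ioc (p.RS - p.RU) (p.Rmax p.RS), 0 < v := fun v hv =>
    (sub_pos.2 hp.RU_lt_RS).trans hv.1
  have key := lintegral_prod_sphere hp.RU_pos hp.RU_lt_RS.le hp.lamS_pos h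
    (Rmin_lt_Rmax_RS hp).le (p.Rmax_le hp.RU_pos hp.RU_lt_RS) (p.measurableSet_visibleCap _)
    (ae_mem_visibleCap_iff hp.RU_pos hp.RU_lt_RS) satelliteGainLaw_ae_nonneg hqm
    (M := fun v => if r < v then ∑ z ∈ Finset.range p.mS, p.zeta z * Gamma (z + 1) /
        (p.beta - p.c + s * p.gainSatellite * p.PS * v ^ (-p.alphaS)) ^ (z + 1) else 0)
    (fun v g hv hg => ?_) (fun v hv => ?_)
    (k := fun t => ENNReal.ofReal (exp (-(s * (t + p.noise))))) (by fun_prop)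
  · have h1 : ∀ ω, (p.emptyEvent N z r).indicator
        (fun ω => ENNReal.ofReal (exp (-(s * p.totalInterference N z J ω)))) ω =
        (∏ i : Fin (N ω), if (z i ω).1 ∈ p.visibleCap p.RS then
          q ‖(z i ω).1 - !₂[0, 0, p.RU]‖ (z i ω).2 else 1) *
          ENNReal.ofReal (exp (-(s * (J ω + p.noise)))) := by
      intro ω
      by_cases hω : ω ∈ p.emptyEvent N z r
      · rw [indicator_of_mem hω, totalInterference, interference, add_assoc, mul_add, neg_add,
          Real.exp_add, ENNReal.ofReal_mul (exp_pos _).le, Finset.mul_sum,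
          ← Finset.sum_neg_distrib, Real.exp_sum,
          ENNReal.ofReal_prod_of_nonneg fun _ _ => (exp_pos _).le]
        congr 1
        refine Finset.prod_congr rfl fun i _ => ?_
        by_cases hi : (z i ω).1 ∈ p.visibleCap p.RS
        · rw [if_pos hi, satelliteWeight, indicator_of_mem hi]
          exact (if_pos (hω i hi)).symm
        · simp [hi, satelliteWeight]
      · rw [indicator_of_notMem hω]
        have : ∃ i : Fin (N ω), (z i ω).1 ∈ p.visibleCap p.RS ∧ ‖(z i ω).1 - p.user‖ ≤ r := by
          by_contra! hcon
          exact hω fun i hi => hcon i hi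
        obtain ⟨i, hi, hi'⟩ := this
        rw [Finset.prod_eq_zero (Finset.mem_univ i), zero_mul]
        rw [if_pos hi]
        exact if_neg (not_lt.2 hi')
    rw [← lintegral_indicator (measurableSet_emptyEvent h r), lintegral_congr h1, key]
    have h2 : ∫⁻ t, ENNReal.ofReal (exp (-(s * (t + p.noise)))) ∂τ =
        ENNReal.ofReal (exp (-(s * p.noise)) * exp (-p.terrestrialExponent o s)) := by
      rw [ENNReal.ofReal_mul (exp_pos _).le, ← hτ s hs, ← lintegral_const_mul _ (by fun_prop)]
      refine lintegral_congr fun t => ?_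
      rw [← ENNReal.ofReal_mul (exp_pos _).le, ← Real.exp_add]
      ring_nf
    have h3 := satelliteExponent_eq_of_mem hp hs hr
    rw [h2, ← ENNReal.ofReal_mul (exp_pos _).le]
    change ENNReal.ofReal (exp (-(2 * π * p.planarDensity p.lamS p.RS *
      ∫ v in (p.Rmin p.RS)..(p.Rmax p.RS), _)) * _) = _
    rw [h3, laplaceInterference, ← Real.exp_add, ← Real.exp_add, ← Real.exp_add]
    congr 2
    ring
  · simp only [hq]
    split_ifs
    · rw [ENNReal.ofReal_le_one, Real.exp_le_one_iff]
      have := Real.rpow_nonneg hv (-p.alphaS)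
      have : 0 ≤ s * (p.gainSatellite * p.PS * g * v ^ (-p.alphaS)) := by positivity
      linarith
    · exact zero_le_one
  · have hv0 := Real.rpow_nonneg (hrR v hv).le (-p.alphaS)
    simp only [hq]
    split_ifs
    · refine ⟨Finset.sum_nonneg fun z _ => ?_, ?_⟩
      · have := zeta_nonneg hp z
        have := Real.Gamma_pos_of_pos (show (0 : ℝ) < z + 1 by positivity)
        positivity
      · have := lintegral_exp_neg_satelliteGain hp
          (s := s * p.gainSatellite * p.PS * v ^ (-p.alphaS)) (by positivity)
        rw [← this]
        refine lintegral_congr fun g => ?_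
        ring_nf
    · simp

/-- The Laplace transform of the terrestrial interference. -/
theorem lintegral_exp_neg_terrestrial (hp : p.Valid) (o : TerrestrialLink)
    [IsProbabilityMeasure (gainLaw (nakagamiPDF p.mT))] {T : Type*} [MeasurableSpace T]
    {τ : Measure T} [IsProbabilityMeasure τ] {J : Ω → T}
    (h : IsPoissonWith P (p.densityTerrestrial o *
        (sphereArea (p.radiusTerrestrial o)).real univ).toNNReal
      ((sphereUniform (p.radiusTerrestrial o)).prod (gainLaw (nakagamiPDF p.mT))) τ N z J)
    {s : ℝ} (hs : 0 ≤ s) :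
    ∫⁻ ω, ENNReal.ofReal (exp (-(s * ∑ i : Fin (N ω), p.terrestrialWeight o (z i ω)))) ∂P =
      ENNReal.ofReal (exp (-p.terrestrialExponent o s)) := by
  classical
  have hG := gainTerrestrial_pos hp o
  have hPT := powerTerrestrial_pos hp o
  have hmT := hp.mT_pos
  -- the farthest visible distance
  obtain ⟨ρ, hR, hlam, hρ, hρ', hAm, hA, hexp⟩ : ∃ ρ, p.RU ≤ p.radiusTerrestrial o ∧
      0 < p.densityTerrestrial o ∧ p.radiusTerrestrial o - p.RU ≤ ρ ∧
      ρ ≤ p.radiusTerrestrial o + p.RU ∧ MeasurableSet (p.visibleTerrestrial o) ∧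
      (∀ᵐ x ∂sphereArea (p.radiusTerrestrial o),
        x ∈ p.visibleTerrestrial o ↔ ‖x - !₂[0, 0, p.RU]‖ ≤ ρ) ∧
      2 * π * (p.densityTerrestrial o * (p.radiusTerrestrial o / p.RU)) *
        (∫ w in (p.radiusTerrestrial o - p.RU)..ρ, (1 - (1 + s * p.gainTerrestrial o *
          p.powerTerrestrial o * w ^ (-p.alphaT) / p.mT) ^ (-p.mT)) * w) =
        p.terrestrialExponent o s := by
    cases o with
    | dn =>
      exact ⟨p.Rmax p.RB, hp.RU_lt_RB.le, hp.lamB_pos,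
        (p.Rmin_lt_Rmax hp.RU_pos hp.RU_lt_RB hp.theta_gt hp.theta_lt).le,
        p.Rmax_le hp.RU_pos hp.RU_lt_RB, p.measurableSet_visibleCap _,
        ae_mem_visibleCap_iff hp.RU_pos hp.RU_lt_RB, rfl⟩
    | up =>
      have hRT := hp.RT_eq_RU
      have h1 := hp.RU_pos
      refine ⟨p.RmaxT, hRT.ge, hp.lamT_pos, ?_, ?_, p.measurableSet_visibleDisc, ?_, ?_⟩
      · change p.RT - p.RU ≤ _
        rw [hRT, sub_self]; exact hp.RmaxT_pos.le
      · change _ ≤ p.RT + p.RU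
        rw [hRT]; linarith [hp.RmaxT_le]
      · filter_upwards [ae_norm_sphereArea (R := p.RT) (by rw [hRT]; exact h1.le)] with x hx
        exact and_iff_right hx
      · change 2 * π * (p.lamT * (p.RT / p.RU)) * (∫ w in (p.RT - p.RU)..p.RmaxT, _) = _
        rw [hRT, div_self h1.ne', mul_one, sub_self]
        rfl
  have hR0 := hp.RU_pos.trans_le hR
  have hRU := hp.RU_pos
  have key := lintegral_prod_sphere hp.RU_pos hR hlam h hρ hρ' hAm hA (ae_nonneg_gainLaw _)
    (q := fun v g => ENNReal.ofReal
      (exp (-(s * (p.gainTerrestrial o * p.powerTerrestrial o * g * v ^ (-p.alphaT))))))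
    (by unfold Function.uncurry; fun_prop)
    (M := fun w => (1 + s * p.gainTerrestrial o *
          p.powerTerrestrial o * w ^ (-p.alphaT) / p.mT) ^ (-p.mT))
    (fun v g hv hg => ?_) (fun v hv => ?_) (k := fun _ => 1) measurable_const
  · rw [hexp] at key
    simp only [mul_one, lintegral_one, measure_univ] at key
    rw [← key]
    refine lintegral_congr fun ω => ?_
    rw [Finset.mul_sum, ← Finset.sum_neg_distrib, Real.exp_sum,
      ENNReal.ofReal_prod_of_nonneg fun _ _ => (exp_pos _).le]
    refine Finset.prod_congr rfl fun i _ => ?_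
    by_cases hi : (z i ω).1 ∈ p.visibleTerrestrial o
    · rw [if_pos hi, terrestrialWeight, indicator_of_mem hi]
      rfl
    · simp [hi, terrestrialWeight]
  · rw [ENNReal.ofReal_le_one, Real.exp_le_one_iff]
    have := Real.rpow_nonneg hv (-p.alphaT)
    have : 0 ≤ s * (p.gainTerrestrial o * p.powerTerrestrial o * g * v ^ (-p.alphaT)) := by
      positivity
    linarith
  · have hv0 : 0 ≤ v := (sub_nonneg.2 hR).trans hv.1.le
    have hv0 := Real.rpow_nonneg hv0 (-p.alphaT)
    refine ⟨by positivity, ?_⟩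
    rw [← lintegral_exp_neg_nakagami hmT (by positivity)]
    refine lintegral_congr fun g => ?_
    ring_nf

end NetworkParams

/-! ### The conditional coverage probability -/

namespace NetworkParams

theorem totalInterference_ge {p : NetworkParams} (hp : p.Valid) {Ω : Type*} {N : Ω → ℕ}
    {z : ℕ → Ω → Space3 × ℝ} {J : Ω → ℝ} (hz : ∀ i ω, 0 ≤ (z i ω).2) (hJ : ∀ ω, 0 ≤ J ω)
    (ω : Ω) : p.noise ≤ p.totalInterference N z J ω := by
  have hG := gainSatellite_pos hp
  have hPS := hp.PS_pos
  have h1 : 0 ≤ ∑ j : Fin (N ω), p.satelliteWeight (z j ω) := by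
    refine Finset.sum_nonneg fun j _ => indicator_nonneg (fun x _ => ?_) _
    have := hz j ω
    positivity
  rw [totalInterference, interference]
  linarith [hJ ω]

variable {p : NetworkParams} {Ω : Type*} [MeasurableSpace Ω] {P : Measure Ω}
  {τ : Measure ℝ} {N : Ω → ℕ} {z : ℕ → Ω → Space3 × ℝ} {J : Ω → ℝ}

/-- The moments of the interference power, weighted by `exp (-s X)`, as derivatives of its Laplace
transform. -/
theorem integral_pow_mul_exp_neg_totalInterference [IsFiniteMeasure P] [SFinite τ] (hp : p.Valid)
    [IsProbabilityMeasure p.satelliteGainLaw]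
    (h : IsPoissonWith P (p.lamS * (sphereArea p.RS).real univ).toNNReal
      ((sphereUniform p.RS).prod p.satelliteGainLaw) τ N z J) {o : TerrestrialLink}
    (hτ : ∀ s, 0 ≤ s → ∫⁻ t, ENNReal.ofReal (exp (-(s * t))) ∂τ =
      ENNReal.ofReal (exp (-p.terrestrialExponent o s)))
    (hz : ∀ i ω, 0 ≤ (z i ω).2) (hJ : ∀ ω, 0 ≤ J ω)
    {r s : ℝ} (hs : 0 < s) (hr : r ∈ Icc (p.Rmin p.RS) (p.Rmax p.RS)) (k : ℕ) :
    IntegrableOn (fun ω => p.totalInterference N z J ω ^ k *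
      exp (-(s * p.totalInterference N z J ω))) (p.emptyEvent N z r) P ∧
    ∫ ω in p.emptyEvent N z r, p.totalInterference N z J ω ^ k *
      exp (-(s * p.totalInterference N z J ω)) ∂P =
      exp (-(p.planarDensity p.lamS p.RS * π * (r ^ 2 - p.Rmin p.RS ^ 2))) *
        ((-1) ^ k * iteratedDeriv k (p.laplaceInterference o r) s) := by
  set X := p.totalInterference N z J with hX
  set K := exp (-(p.planarDensity p.lamS p.RS * π * (r ^ 2 - p.Rmin p.RS ^ 2)))
  set μ := P.restrict (p.emptyEvent N z r) with hμ
  have hXm : Measurable X := measurable_totalInterference h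
  have hX0 : ∀ ω, 0 ≤ X ω := fun ω => hp.noise_pos.le.trans (totalInterference_ge hp hz hJ ω)
  -- `-X` is bounded above, so that its moment generating function is finite on `[0, ∞)`
  have hmem : ∀ t, 0 ≤ t → t ∈ integrableExpSet (fun ω => -X ω) μ := by
    intro t ht
    refine Integrable.of_bound (by fun_prop) 1 (ae_of_all _ fun ω => ?_)
    rw [Real.norm_of_nonneg (exp_pos _).le, Real.exp_le_one_iff]
    nlinarith [mul_nonneg ht (hX0 ω)]
  have hint : s ∈ interior (integrableExpSet (fun ω => -X ω) μ) :=
    mem_interior.2 ⟨Ioi 0, fun t ht => hmem t (le_of_lt ht), isOpen_Ioi, hs⟩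
  have hmgf : mgf (fun ω => -X ω) μ =ᶠ[nhds s] fun t => K * p.laplaceInterference o r t := by
    filter_upwards [Ioi_mem_nhds hs] with t ht
    have ht : (0 : ℝ) ≤ t := le_of_lt ht
    have h1 := setLIntegral_exp_neg_totalInterference hp h hτ ht hr
    rw [mgf, integral_eq_lintegral_of_nonneg_ae (ae_of_all _ fun ω => (exp_pos _).le)
      (by fun_prop)]
    simp_rw [mul_neg]
    rw [h1, ENNReal.toReal_ofReal]
    exact mul_nonneg (exp_pos _).le (exp_pos _).le
  have hsign : ∀ ω, X ω ^ k * exp (-(s * X ω)) = (-1) ^ k * ((-X ω) ^ k * exp (s * -X ω)) := by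
    intro ω
    rw [← mul_assoc, ← mul_pow, neg_one_mul, neg_neg, mul_neg]
  have hderiv := iteratedDeriv_mgf hint k
  rw [hmgf.iteratedDeriv_eq, iteratedDeriv_const_mul_field] at hderiv
  simp_rw [hsign]
  refine ⟨(integrable_pow_mul_exp_of_mem_interior_integrableExpSet hint k).const_mul _, ?_⟩
  rw [integral_const_mul, ← hderiv]
  ring

/-- The constant term of `coverage` vanishes, since the weights of the satellite gain law add up to
`1`. -/
theorem coverage_eq (hp : p.Valid) [IsProbabilityMeasure p.satelliteGainLaw]
    (o : TerrestrialLink) (γ r : ℝ) :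
    p.coverage o γ r = ∑ z ∈ Finset.range p.mS,
      p.zeta z * Gamma (z + 1) / (p.beta - p.c) ^ (z + 1) * ∑ v ∈ Finset.range (z + 1),
        ((p.beta - p.c) * γ * r ^ p.alphaS / (p.gainServing * p.PS)) ^ v / (v.factorial : ℝ) *
          ((-1) ^ v * iteratedDeriv v (p.laplaceInterference o r)
            ((p.beta - p.c) * γ * r ^ p.alphaS / (p.gainServing * p.PS))) := by
  have h1 : ∑ z ∈ Finset.range p.mS, p.zeta z * Gamma (z + 1) / (p.beta - p.c) ^ (z + 1) = 1 := by
    have h := lintegral_exp_neg_satelliteGain hp le_rfl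
    simp only [zero_mul, neg_zero, Real.exp_zero, ENNReal.ofReal_one, lintegral_one, measure_univ,
      add_zero] at h
    exact (ENNReal.ofReal_eq_one.1 h.symm)
  rw [coverage]
  simp_rw [mul_sub, mul_one]
  rw [Finset.sum_sub_distrib, h1, sub_sub_cancel]
  refine Finset.sum_congr rfl fun z _ => ?_
  congr 1
  refine Finset.sum_congr rfl fun v _ => ?_
  rw [div_pow, mul_assoc _ ((-1) ^ v), div_div]

/-- The coverage probability: given that the serving satellite is at distance `r`, the gain of the
serving link is integrated first, which leaves a combination of moments of the interference. -/
theorem lintegral_meanAt_indicator [IsFiniteMeasure P] [SFinite τ] (hp : p.Valid)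
    [IsProbabilityMeasure p.satelliteGainLaw]
    (h : IsPoissonWith P (p.lamS * (sphereArea p.RS).real univ).toNNReal
      ((sphereUniform p.RS).prod p.satelliteGainLaw) τ N z J) {o : TerrestrialLink}
    (hτ : ∀ s, 0 ≤ s → ∫⁻ t, ENNReal.ofReal (exp (-(s * t))) ∂τ =
      ENNReal.ofReal (exp (-p.terrestrialExponent o s)))
    (hz : ∀ i ω, 0 ≤ (z i ω).2) (hJ : ∀ ω, 0 ≤ J ω)
    {γ r : ℝ} (hγ : 0 < γ) (hr : r ∈ Icc (p.Rmin p.RS) (p.Rmax p.RS)) :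
    0 ≤ p.coverage o γ r ∧
    ∫⁻ g, p.meanAt P N z J ((Ioi γ).indicator 1) r g ∂p.satelliteGainLaw =
      ENNReal.ofReal (exp (-(p.planarDensity p.lamS p.RS * π * (r ^ 2 - p.Rmin p.RS ^ 2))) *
        p.coverage o γ r) := by
  have hδ := beta_sub_c_pos hp
  have hG : 0 < p.gainServing * p.PS := mul_pos (gainServing_pos hp) hp.PS_pos
  have hr0 : 0 < r := (Rmin_pos hp).trans_le hr.1
  have hrα := Real.rpow_pos_of_pos hr0 p.alphaS
  set X := p.totalInterference N z J with hX
  set E := p.emptyEvent N z r with hE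
  set K := exp (-(p.planarDensity p.lamS p.RS * π * (r ^ 2 - p.Rmin p.RS ^ 2))) with hK
  set s := (p.beta - p.c) * γ * r ^ p.alphaS / (p.gainServing * p.PS) with hs
  have hs0 : 0 < s := by positivity
  have hX0 : ∀ ω, 0 < X ω := fun ω => hp.noise_pos.trans_le (totalInterference_ge hp hz hJ ω)
  have hEm : MeasurableSet E := measurableSet_emptyEvent h r
  set w : Ω → ℝ := fun ω => ∑ z ∈ Finset.range p.mS,
      p.zeta z * Gamma (z + 1) / (p.beta - p.c) ^ (z + 1) * ∑ v ∈ Finset.range (z + 1),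
        s ^ v / (v.factorial : ℝ) * (X ω ^ v * exp (-(s * X ω))) with hw
  have hmom := integral_pow_mul_exp_neg_totalInterference hp h hτ hz hJ hs0 hr
  have hi1 : ∀ z, Integrable (fun ω => ∑ v ∈ Finset.range (z + 1),
      s ^ v / (v.factorial : ℝ) * (X ω ^ v * exp (-(s * X ω)))) (P.restrict E) := fun z =>
    integrable_finsetSum _ fun v _ => (hmom v).1.const_mul _
  have hwint : Integrable w (P.restrict E) :=
    integrable_finsetSum _ fun z _ => (hi1 z).const_mul _
  have hw0 : ∀ ω, 0 ≤ w ω := by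
    intro ω
    refine Finset.sum_nonneg fun z _ => mul_nonneg ?_ (Finset.sum_nonneg fun v _ => ?_)
    · have := zeta_nonneg hp z
      have := Real.Gamma_pos_of_pos (show (0 : ℝ) < z + 1 by positivity)
      positivity
    · have := hX0 ω
      positivity
  have hwI : ∫ ω in E, w ω ∂P = K * p.coverage o γ r := by
    simp only [hw]
    rw [coverage_eq hp, integral_finsetSum _ fun z _ => (hi1 z).const_mul _, Finset.mul_sum]
    refine Finset.sum_congr rfl fun z _ => ?_
    rw [integral_const_mul, integral_finsetSum _ fun v _ => (hmom v).1.const_mul _,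
      mul_left_comm K]
    congr 1
    rw [Finset.mul_sum]
    refine Finset.sum_congr rfl fun v _ => ?_
    rw [integral_const_mul, (hmom v).2]
    ring
  have hcov : 0 ≤ K * p.coverage o γ r := hwI ▸ integral_nonneg hw0
  refine ⟨nonneg_of_mul_nonneg_right hcov (exp_pos _), ?_⟩
  have hind : Measurable ((Ioi γ).indicator (1 : ℝ → ENNReal)) :=
    measurable_one.indicator measurableSet_Ioi
  have hmeas := (measurable_meanAt_integrand (p := p) h hind).comp
    (show Measurable fun a : ℝ × Ω => ((r, a.1), a.2) by fun_prop)
  simp only [meanAt]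
  refine (lintegral_lintegral_swap (f := fun g ω => E.indicator (fun ω => (Ioi γ).indicator 1
    (p.gainServing * p.PS * g * r ^ (-p.alphaS) / X ω)) ω) hmeas.aemeasurable).trans ?_
  rw [← hwI,
    ofReal_integral_eq_lintegral_ofReal hwint (ae_of_all _ hw0), ← lintegral_indicator hEm]
  refine lintegral_congr fun ω => ?_
  by_cases hω : ω ∈ E
  · simp only [indicator_of_mem hω]
    have hy : 0 ≤ γ * r ^ p.alphaS * X ω / (p.gainServing * p.PS) := by
      have := hX0 ω
      positivity
    have h1 : ∀ g, (Ioi γ).indicator (1 : ℝ → ENNReal)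
        (p.gainServing * p.PS * g * r ^ (-p.alphaS) / X ω) =
        (Ioi (γ * r ^ p.alphaS * X ω / (p.gainServing * p.PS))).indicator 1 g := by
      intro g
      simp only [indicator, mem_Ioi, Pi.one_apply]
      refine if_congr ?_ rfl rfl
      rw [lt_div_iff₀ (hX0 ω), Real.rpow_neg hr0.le, ← div_eq_mul_inv, lt_div_iff₀ hrα,
        div_lt_iff₀ hG]
      constructor <;> intro h <;> linarith
    simp_rw [h1]
    rw [lintegral_indicator_one measurableSet_Ioi, satelliteGainLaw_Ioi hp hy]
    congr 1
    refine Finset.sum_congr rfl fun z _ => ?_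
    congr 1
    refine Finset.sum_congr rfl fun v _ => ?_
    have : (p.beta - p.c) * (γ * r ^ p.alphaS * X ω / (p.gainServing * p.PS)) = s * X ω := by
      rw [hs]; ring
    rw [this, mul_pow]
    ring
  · simp [hω]

end NetworkParams

/-! ### Tail of the SINR and layer-cake formula -/

theorem integral_logb_exp_div_one_add {s : ℝ} (hs : 0 ≤ s) :
    ∫ t in (0 : ℝ)..s, logb 2 (exp 1) / (1 + t) = logb 2 (1 + s) := by
  have h1 : ∀ t ∈ uIcc 0 s, HasDerivAt (fun t => logb 2 (1 + t)) (logb 2 (exp 1) / (1 + t)) t := by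
    intro t ht
    rw [uIcc_of_le hs] at ht
    have : HasDerivAt (fun t : ℝ => log (1 + t) / log 2) (1 / (1 + t) / log 2) t :=
      (((hasDerivAt_id t).const_add 1).log (by simpa using (by linarith [ht.1] : 1 + t ≠ 0))).div_const _
    refine this.congr_deriv ?_
    rw [logb, log_exp]; ring
  have hc : ContinuousOn (fun t : ℝ => logb 2 (exp 1) / (1 + t)) (uIcc 0 s) := by
    rw [uIcc_of_le hs]
    exact continuousOn_const.div (by fun_prop) fun t ht => by linarith [ht.1]
  rw [intervalIntegral.integral_eq_sub_of_hasDerivAt h1 hc.intervalIntegrable]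
  simp

/-- The layer-cake formula for `log₂ (1 + S)`, when `S` has the tail function `T`. -/
theorem integral_logb_one_add {Ω : Type*} [MeasurableSpace Ω] {P : Measure Ω} [IsFiniteMeasure P]
    {S : Ω → ℝ} (hS0 : ∀ ω, 0 ≤ S ω) (hS : Integrable S P) {T : ℝ → ℝ}
    (hT : ∀ γ, 0 < γ → 0 ≤ T γ ∧ P {ω | γ < S ω} = ENNReal.ofReal (T γ)) :
    Integrable (fun ω => logb 2 (1 + S ω)) P ∧
    IntegrableOn (fun γ => T γ * (logb 2 (exp 1) / (1 + γ))) (Ioi 0) ∧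
    ∫ ω, logb 2 (1 + S ω) ∂P = ∫ γ in Ioi (0 : ℝ), T γ * (logb 2 (exp 1) / (1 + γ)) := by
  have hl2 : 0 < log 2 := log_pos one_lt_two
  have hle : 0 ≤ logb 2 (exp 1) := logb_nonneg one_lt_two (one_le_exp zero_le_one)
  have hm : AEMeasurable S P := hS.aestronglyMeasurable.aemeasurable
  have hlog0 : ∀ ω, 0 ≤ logb 2 (1 + S ω) := fun ω =>
    logb_nonneg one_lt_two (by linarith [hS0 ω])
  have hlogm : AEStronglyMeasurable (fun ω => logb 2 (1 + S ω)) P := by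
    simp only [logb]
    exact ((measurable_log.comp_aemeasurable (hm.const_add 1)).div_const _).aestronglyMeasurable
  have hint : Integrable (fun ω => logb 2 (1 + S ω)) P := by
    refine (hS.div_const (log 2)).mono' hlogm (ae_of_all _ fun ω => ?_)
    rw [Real.norm_of_nonneg (hlog0 ω), logb]
    have := log_le_sub_one_of_pos (show 0 < 1 + S ω by linarith [hS0 ω])
    gcongr
    linarith
  have hnn : ∀ᵐ γ ∂volume.restrict (Ioi (0 : ℝ)), 0 ≤ T γ * (logb 2 (exp 1) / (1 + γ)) := by
    filter_upwards [ae_restrict_mem measurableSet_Ioi] with γ hγ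
    have hγ : (0 : ℝ) < γ := hγ
    have := (hT γ hγ).1
    positivity
  have hcake : ∫⁻ ω, ENNReal.ofReal (logb 2 (1 + S ω)) ∂P =
      ∫⁻ γ in Ioi (0 : ℝ), ENNReal.ofReal (T γ * (logb 2 (exp 1) / (1 + γ))) := by
    simp_rw [fun ω => (integral_logb_exp_div_one_add (hS0 ω)).symm]
    rw [lintegral_comp_eq_lintegral_meas_lt_mul P (ae_of_all _ hS0) hm]
    · refine setLIntegral_congr_fun measurableSet_Ioi fun γ hγ => ?_
      rw [(hT γ hγ).2, ENNReal.ofReal_mul (hT γ hγ).1]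
    · intro t ht
      refine ContinuousOn.intervalIntegrable ?_
      rw [uIcc_of_le (le_of_lt ht)]
      exact continuousOn_const.div (by fun_prop) fun t ht => by linarith [ht.1]
    · filter_upwards [ae_restrict_mem measurableSet_Ioi] with γ hγ
      have hγ : (0 : ℝ) < γ := hγ
      positivity
  have hTm : AEStronglyMeasurable (fun γ => T γ * (logb 2 (exp 1) / (1 + γ)))
      (volume.restrict (Ioi 0)) := by
    have hanti : Antitone fun γ => P {ω | γ < S ω} := fun a b hab =>
      measure_mono fun ω (hω : b < S ω) => lt_of_le_of_lt hab hω
    have : Measurable fun γ => (P {ω | γ < S ω}).toReal * (logb 2 (exp 1) / (1 + γ)) :=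
      hanti.measurable.ennreal_toReal.mul (by fun_prop)
    refine this.aestronglyMeasurable.congr ?_
    filter_upwards [ae_restrict_mem measurableSet_Ioi] with γ hγ
    rw [(hT γ hγ).2, ENNReal.toReal_ofReal (hT γ hγ).1]
  refine ⟨hint, ⟨hTm, ?_⟩, ?_⟩
  · rw [hasFiniteIntegral_iff_ofReal hnn, ← hcake]
    exact (hasFiniteIntegral_iff_ofReal (ae_of_all _ hlog0)).1 hint.hasFiniteIntegral
  · rw [integral_eq_lintegral_of_nonneg_ae (ae_of_all _ hlog0) hlogm,
      integral_eq_lintegral_of_nonneg_ae hnn hTm, hcake]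

theorem ProbabilityTheory.IndepFun.prodMk_right_of_prodMk_left {Ω α β γ : Type*}
    [MeasurableSpace Ω] [MeasurableSpace α] [MeasurableSpace β] [MeasurableSpace γ]
    {P : Measure Ω} [IsProbabilityMeasure P] {A : Ω → α} {B : Ω → β} {C : Ω → γ}
    (hA : Measurable A) (hB : Measurable B) (hC : Measurable C) (hAB : IndepFun A B P)
    (hABC : IndepFun (fun ω => (A ω, B ω)) C P) : IndepFun A (fun ω => (B ω, C ω)) P := by
  have hBC : IndepFun B C P := hABC.comp measurable_snd measurable_id
  rw [indepFun_iff_map_prod_eq_prod_map_map hA.aemeasurable (hB.prodMk hC).aemeasurable,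
    (indepFun_iff_map_prod_eq_prod_map_map hB.aemeasurable hC.aemeasurable).1 hBC]
  have h1 := (indepFun_iff_map_prod_eq_prod_map_map (hA.prodMk hB).aemeasurable
    hC.aemeasurable).1 hABC
  rw [(indepFun_iff_map_prod_eq_prod_map_map hA.aemeasurable hB.aemeasurable).1 hAB] at h1
  have := Measure.isProbabilityMeasure_map (μ := P) hA.aemeasurable
  have := Measure.isProbabilityMeasure_map (μ := P) hB.aemeasurable
  have := Measure.isProbabilityMeasure_map (μ := P) hC.aemeasurable
  rw [← (measurePreserving_prodAssoc (P.map A) (P.map B) (P.map C)).map_eq, ← h1,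
    Measure.map_map MeasurableEquiv.prodAssoc.measurable ((hA.prodMk hB).prodMk hC)]
  rfl

theorem sphereUniform_dist_eq {R a : ℝ} (ha : 0 < a) (haR : a ≤ R) (r : ℝ) :
    sphereUniform R {x | ‖x - !₂[0, 0, a]‖ = r} = 0 := by
  have h1 : (sphereArea R).map (fun x => ‖x - !₂[0, 0, a]‖) {r} = 0 := by
    rw [map_dist_sphereArea ha haR]
    refine withDensity_absolutelyContinuous _ _ ?_
    exact le_antisymm ((Measure.restrict_apply_le _ _).trans_eq Real.volume_singleton) zero_le
  rw [Measure.map_apply (measurable_norm_sub _) (measurableSet_singleton r)] at h1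
  rw [sphereUniform, Measure.smul_apply, show {x : Space3 | ‖x - !₂[0, 0, a]‖ = r} =
    (fun x => ‖x - !₂[0, 0, a]‖) ⁻¹' {r} from rfl, h1, smul_zero]

namespace NetworkParams

theorem measurableSet_visibleTerrestrial (p : NetworkParams) (o : TerrestrialLink) :
    MeasurableSet (p.visibleTerrestrial o) := by
  cases o
  exacts [p.measurableSet_visibleCap _, p.measurableSet_visibleDisc]

theorem measurable_terrestrialWeight (p : NetworkParams) (o : TerrestrialLink) :
    Measurable (p.terrestrialWeight o) := by
  have : p.terrestrialWeight o = (Prod.fst ⁻¹' p.visibleTerrestrial o).indicator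
      fun ξ : Space3 × ℝ => p.gainTerrestrial o * p.powerTerrestrial o * ξ.2 *
        ‖ξ.1 - p.user‖ ^ (-p.alphaT) := rfl
  rw [this]
  refine Measurable.indicator ?_ (measurable_fst (p.measurableSet_visibleTerrestrial o))
  fun_prop

theorem terrestrialWeight_nonneg {p : NetworkParams} (hp : p.Valid) (o : TerrestrialLink)
    {ξ : Space3 × ℝ} (hξ : 0 ≤ ξ.2) : 0 ≤ p.terrestrialWeight o ξ := by
  have := gainTerrestrial_pos hp o
  have := powerTerrestrial_pos hp o
  exact indicator_nonneg (fun x _ => by positivity) _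

theorem sinr_nonneg {p : NetworkParams} (hp : p.Valid) (o : TerrestrialLink) (n : ℕ)
    (x : ℕ → Space3) {h : ℕ → ℝ} (hh : ∀ i, 0 ≤ h i) (k : ℕ) (y : ℕ → Space3) {g : ℕ → ℝ}
    (hg : ∀ i, 0 ≤ g i) : 0 ≤ p.sinr o n x h k y g := by
  have := gainServing_pos hp
  have := gainSatellite_pos hp
  have := gainTerrestrial_pos hp o
  have := powerTerrestrial_pos hp o
  have := hp.PS_pos
  have := hp.noise_pos
  rw [sinr]
  split_ifs
  · refine div_nonneg (mul_nonneg (mul_nonneg (by positivity) (hh _)) (by positivity)) ?_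
    refine add_nonneg (add_nonneg (Finset.sum_nonneg fun i _ => ?_)
      (Finset.sum_nonneg fun i _ => ?_)) (by positivity)
    · exact mul_nonneg (mul_nonneg (by positivity) (hh _)) (by positivity)
    · exact mul_nonneg (mul_nonneg (by positivity) (hg _)) (by positivity)
  · exact le_rfl

theorem visibleProb_pos {p : NetworkParams} (hp : p.Valid) : 0 < p.visibleProb := by
  have h1 := planarDensity_pos hp
  have h2 := Rmin_pos hp
  have h3 := Rmin_lt_Rmax_RS hp
  rw [visibleProb, sub_pos, Real.exp_lt_one_iff]
  have : 0 < p.Rmax p.RS ^ 2 - p.Rmin p.RS ^ 2 := by nlinarith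
  have := mul_pos (mul_pos h1 pi_pos) this
  linarith

theorem visibleProb_mul_nearestPDF {p : NetworkParams} (hp : p.Valid) (r : ℝ) :
    p.visibleProb * p.nearestPDF r = 2 * π * p.planarDensity p.lamS p.RS * r *
      exp (-(p.planarDensity p.lamS p.RS * π * (r ^ 2 - p.Rmin p.RS ^ 2))) := by
  have hv := (visibleProb_pos hp).ne'
  rw [nearestPDF, show -(p.planarDensity p.lamS p.RS * π * (r ^ 2 - p.Rmin p.RS ^ 2)) =
    p.planarDensity p.lamS p.RS * π * p.Rmin p.RS ^ 2 + -p.planarDensity p.lamS p.RS * π * r ^ 2 by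
      ring, Real.exp_add]
  field_simp

variable {p : NetworkParams} {Ω : Type*} [MeasurableSpace Ω] {P : Measure Ω}
  {τ : Measure ℝ} {N : Ω → ℕ} {z : ℕ → Ω → Space3 × ℝ} {J : Ω → ℝ}

/-- The mean SINR is finite: noise and the least distance bound it by a multiple of the gain of the
serving link. -/
theorem lintegral_servingSum_ofReal_lt_top [IsFiniteMeasure P] [SFinite τ] (hp : p.Valid)
    [IsProbabilityMeasure p.satelliteGainLaw]
    (h : IsPoissonWith P (p.lamS * (sphereArea p.RS).real univ).toNNReal
      ((sphereUniform p.RS).prod p.satelliteGainLaw) τ N z J)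
    (hz : ∀ i ω, 0 ≤ (z i ω).2) (hJ : ∀ ω, 0 ≤ J ω) :
    ∫⁻ ω, p.servingSum ENNReal.ofReal (N ω) (fun i => z i ω, J ω) ∂P < ⊤ := by
  have hmin := Rmin_pos hp
  have hG : 0 < p.gainServing * p.PS := mul_pos (gainServing_pos hp) hp.PS_pos
  have hno := hp.noise_pos
  have hlam := planarDensity_pos hp
  set C := p.gainServing * p.PS * p.Rmin p.RS ^ (-p.alphaS) / p.noise with hC
  have hC0 : 0 ≤ C := by positivity
  set D := ∫⁻ g, ENNReal.ofReal g ∂p.satelliteGainLaw with hD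
  have hDt : D < ⊤ := lintegral_satelliteGain_lt_top hp
  have h1 : ∀ v ∈ Ioc (p.Rmin p.RS) (p.Rmax p.RS),
      ∫⁻ g, p.meanAt P N z J ENNReal.ofReal v g ∂p.satelliteGainLaw ≤
        ENNReal.ofReal C * P univ * D := by
    intro v hv
    rw [hD, ← lintegral_const_mul _ (by fun_prop)]
    refine lintegral_mono_ae ?_
    filter_upwards [satelliteGainLaw_ae_nonneg (p := p)] with g hg
    rw [meanAt, mul_right_comm (ENNReal.ofReal C), ← ENNReal.ofReal_mul hC0, ← lintegral_const]
    refine lintegral_mono fun ω => (indicator_le_self _ _ _).trans (ENNReal.ofReal_le_ofReal ?_)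
    have hX := totalInterference_ge (N := N) hp hz hJ ω
    have hv0 : 0 < v := hmin.trans hv.1
    have h2 : v ^ (-p.alphaS) ≤ p.Rmin p.RS ^ (-p.alphaS) :=
      Real.rpow_le_rpow_of_nonpos hmin hv.1.le (neg_nonpos.2 hp.alphaS_pos.le)
    calc p.gainServing * p.PS * g * v ^ (-p.alphaS) / p.totalInterference N z J ω
        ≤ p.gainServing * p.PS * g * p.Rmin p.RS ^ (-p.alphaS) / p.noise := by gcongr
      _ = C * g := by rw [hC]; ring
  rw [lintegral_servingSum hp h ENNReal.measurable_ofReal]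
  calc _ ≤ ∫⁻ v in Ioc (p.Rmin p.RS) (p.Rmax p.RS),
        ENNReal.ofReal (2 * π * p.planarDensity p.lamS p.RS * p.Rmax p.RS) *
          (ENNReal.ofReal C * P univ * D) := by
        refine setLIntegral_mono' measurableSet_Ioc fun v hv => ?_
        refine mul_le_mul' (ENNReal.ofReal_le_ofReal ?_) (h1 v hv)
        have := hv.2
        gcongr
    _ < ⊤ := by
        rw [setLIntegral_const, Real.volume_Ioc]
        have := hDt.ne
        finiteness

/-- The tail of the SINR, in terms of the conditional coverage probability. The finiteness
hypothesis holds because the left side is a probability; it yields the integrability in `r`. -/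
theorem lintegral_servingSum_indicator [IsFiniteMeasure P] [SFinite τ] (hp : p.Valid)
    [IsProbabilityMeasure p.satelliteGainLaw]
    (h : IsPoissonWith P (p.lamS * (sphereArea p.RS).real univ).toNNReal
      ((sphereUniform p.RS).prod p.satelliteGainLaw) τ N z J) {o : TerrestrialLink}
    (hτ : ∀ s, 0 ≤ s → ∫⁻ t, ENNReal.ofReal (exp (-(s * t))) ∂τ =
      ENNReal.ofReal (exp (-p.terrestrialExponent o s)))
    (hz : ∀ i ω, 0 ≤ (z i ω).2) (hJ : ∀ ω, 0 ≤ J ω) {γ : ℝ} (hγ : 0 < γ)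
    (hfin : ∫⁻ ω, p.servingSum ((Ioi γ).indicator (1 : ℝ → ENNReal)) (N ω)
      (fun i => z i ω, J ω) ∂P < ⊤) :
    IntervalIntegrable (fun r => p.coverage o γ r * p.nearestPDF r) volume
      (p.Rmin p.RS) (p.Rmax p.RS) ∧
    0 ≤ p.visibleProb * (∫ r in (p.Rmin p.RS)..(p.Rmax p.RS),
      p.coverage o γ r * p.nearestPDF r) ∧
    ∫⁻ ω, p.servingSum ((Ioi γ).indicator (1 : ℝ → ENNReal)) (N ω) (fun i => z i ω, J ω) ∂P =
      ENNReal.ofReal (p.visibleProb * ∫ r in (p.Rmin p.RS)..(p.Rmax p.RS),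
        p.coverage o γ r * p.nearestPDF r) := by
  have hlam := planarDensity_pos hp
  have hvp := visibleProb_pos hp
  have hle := (Rmin_lt_Rmax_RS hp).le
  have hind : Measurable ((Ioi γ).indicator (1 : ℝ → ENNReal)) :=
    measurable_one.indicator measurableSet_Ioi
  have hcov := fun r (hr : r ∈ Ioc (p.Rmin p.RS) (p.Rmax p.RS)) =>
    lintegral_meanAt_indicator hp h hτ hz hJ hγ (Ioc_subset_Icc_self hr)
  have hr0 : ∀ r ∈ Ioc (p.Rmin p.RS) (p.Rmax p.RS), 0 ≤ r := fun r hr =>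
    ((Rmin_pos hp).trans hr.1).le
  have hpt : ∀ r ∈ Ioc (p.Rmin p.RS) (p.Rmax p.RS),
      0 ≤ p.visibleProb * (p.coverage o γ r * p.nearestPDF r) ∧
      ENNReal.ofReal (2 * π * p.planarDensity p.lamS p.RS * r) *
        ∫⁻ g, p.meanAt P N z J ((Ioi γ).indicator 1) r g ∂p.satelliteGainLaw =
      ENNReal.ofReal (p.visibleProb * (p.coverage o γ r * p.nearestPDF r)) := by
    intro r hr
    have h0 := hr0 r hr
    have h1 := (hcov r hr).1
    rw [(hcov r hr).2, ← ENNReal.ofReal_mul (by positivity), mul_left_comm p.visibleProb,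
      visibleProb_mul_nearestPDF hp]
    refine ⟨by positivity, ?_⟩
    congr 1; ring
  have hlin := lintegral_servingSum hp h hind
  rw [setLIntegral_congr_fun measurableSet_Ioc fun r hr => (hpt r hr).2] at hlin
  have hnn : ∀ᵐ r ∂volume.restrict (Ioc (p.Rmin p.RS) (p.Rmax p.RS)),
      0 ≤ p.visibleProb * (p.coverage o γ r * p.nearestPDF r) := by
    filter_upwards [ae_restrict_mem measurableSet_Ioc] with r hr using (hpt r hr).1
  have hm : AEStronglyMeasurable (fun r => p.visibleProb * (p.coverage o γ r * p.nearestPDF r))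
      (volume.restrict (Ioc (p.Rmin p.RS) (p.Rmax p.RS))) := by
    have : Measurable fun r => (ENNReal.ofReal (2 * π * p.planarDensity p.lamS p.RS * r) *
        ∫⁻ g, p.meanAt P N z J ((Ioi γ).indicator 1) r g ∂p.satelliteGainLaw).toReal :=
      (Measurable.mul (by fun_prop) (measurable_meanAt h hind).lintegral_prod_right').ennreal_toReal
    refine this.aestronglyMeasurable.congr ?_
    filter_upwards [ae_restrict_mem measurableSet_Ioc] with r hr
    rw [(hpt r hr).2, ENNReal.toReal_ofReal (hpt r hr).1]
  have hint : IntegrableOn (fun r => p.visibleProb * (p.coverage o γ r * p.nearestPDF r))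
      (Ioc (p.Rmin p.RS) (p.Rmax p.RS)) :=
    ⟨hm, (hasFiniteIntegral_iff_ofReal hnn).2 (hlin ▸ hfin)⟩
  rw [intervalIntegrable_iff_integrableOn_Ioc_of_le hle, intervalIntegral.integral_of_le hle,
    ← integral_const_mul]
  refine ⟨?_, integral_nonneg_of_ae hnn, ?_⟩
  · have := hint.const_mul (p.visibleProb⁻¹)
    simp only [inv_mul_cancel_left₀ hvp.ne'] at this
    exact this
  · rw [hlin, ofReal_integral_eq_lintegral_ofReal hint hnn]

end NetworkParams

/-! ### Ergodic spectral efficiency -/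

theorem NetworkParams.measurable_terrestrialInterference (p : NetworkParams)
    (o : TerrestrialLink) :
    Measurable fun a : (ℕ × (ℕ → Space3)) × (ℕ → ℝ) =>
      ∑ i : Fin a.1.1, p.terrestrialWeight o (a.1.2 i, a.2 i) := by
  have h : Measurable fun b : ℕ × ((ℕ → Space3) × (ℕ → ℝ)) =>
      ∑ i : Fin b.1, p.terrestrialWeight o (b.2.1 i, b.2.2 i) := by
    refine measurable_from_prod_countable_right fun k => ?_
    have h1 : ∀ i : Fin k, Measurable fun b : (ℕ → Space3) × (ℕ → ℝ) => (b.1 i, b.2 i) := fun i =>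
      ((measurable_pi_apply _).comp measurable_fst).prodMk
        ((measurable_pi_apply _).comp measurable_snd)
    have h2 : Measurable fun b : (ℕ → Space3) × (ℕ → ℝ) =>
        ∑ i : Fin k, p.terrestrialWeight o (b.1 i, b.2 i) :=
      Finset.measurable_sum _ fun i _ => (p.measurable_terrestrialWeight o).comp (h1 i)
    exact h2
  exact h.comp ((measurable_fst.comp measurable_fst).prodMk
    ((measurable_snd.comp measurable_fst).prodMk measurable_snd))

theorem theorem2 {Ω : Type*} [MeasurableSpace Ω] (P : Measure Ω) [IsProbabilityMeasure P]
    (p : NetworkParams) (hp : p.Valid) (o : TerrestrialLink)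
    -- satellites and their fading
    (N : Ω → ℕ) (x : ℕ → Ω → Space3) (H : ℕ → Ω → ℝ)
    -- terrestrial interferers and their fading
    (K : Ω → ℕ) (y : ℕ → Ω → Space3) (G : ℕ → Ω → ℝ)
    (hx : IsSphericalPoisson P p.RS p.lamS N x)
    (hy : IsSphericalPoisson P (p.radiusTerrestrial o) (p.densityTerrestrial o) K y)
    (hH : IsFading P (shadowedRicianPDF p.mS p.b p.Om) H)
    (hG : IsFading P (nakagamiPDF p.mT) G)
    -- the four families are independent
    (hxH : IndepFun (fun ω => (N ω, fun i => x i ω)) (fun ω i => H i ω) P)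
    (hxHy : IndepFun (fun ω => ((N ω, fun i => x i ω), fun i => H i ω))
      (fun ω => (K ω, fun i => y i ω)) P)
    (hxHyG : IndepFun
      (fun ω => (((N ω, fun i => x i ω), fun i => H i ω), (K ω, fun i => y i ω)))
      (fun ω i => G i ω) P) :
    Integrable (fun ω => logb 2 (1 + p.sinr o (N ω) (fun i => x i ω) (fun i => H i ω)
      (K ω) (fun i => y i ω) (fun i => G i ω))) P ∧
    (∀ γ : ℝ, 0 < γ → IntervalIntegrable (p.rateIntegrand o γ) volume
      (p.Rmin p.RS) (p.Rmax p.RS)) ∧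
    IntegrableOn (fun γ => ∫ r in p.Rmin p.RS..p.Rmax p.RS, p.rateIntegrand o γ r) (Ioi 0) ∧
    ∫ ω, logb 2 (1 + p.sinr o (N ω) (fun i => x i ω) (fun i => H i ω)
      (K ω) (fun i => y i ω) (fun i => G i ω)) ∂P =
      p.visibleProb *
        ∫ γ in Ioi (0 : ℝ), ∫ r in p.Rmin p.RS..p.Rmax p.RS, p.rateIntegrand o γ r := by

  classical
  have hRS : 0 < p.RS := hp.RU_pos.trans hp.RU_lt_RS
  have hRq : 0 < p.radiusTerrestrial o := by
    cases o
    · exact hp.RU_pos.trans hp.RU_lt_RB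
    · exact hp.RU_pos.trans_eq hp.RT_eq_RU.symm
  have hlq : 0 < p.densityTerrestrial o := by
    cases o
    exacts [hp.lamB_pos, hp.lamT_pos]
  have hHmap : ∀ i, P.map (H i) = p.satelliteGainLaw := hH.map_eq_gainLaw
  have hGmap := hG.map_eq_gainLaw
  have : IsProbabilityMeasure p.satelliteGainLaw :=
    hHmap 0 ▸ Measure.isProbabilityMeasure_map (hH.measurable 0).aemeasurable
  have : IsProbabilityMeasure (gainLaw (nakagamiPDF p.mT)) :=
    hGmap 0 ▸ Measure.isProbabilityMeasure_map (hG.measurable 0).aemeasurable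
  have := isProbabilityMeasure_sphereUniform hRS
  have hNxm : Measurable fun ω => (N ω, fun i => x i ω) :=
    hx.measurable_card.prodMk (measurable_pi_lambda _ hx.measurable_point)
  have hKym : Measurable fun ω => (K ω, fun i => y i ω) :=
    hy.measurable_card.prodMk (measurable_pi_lambda _ hy.measurable_point)
  have hHm : Measurable fun ω i => H i ω := measurable_pi_lambda _ hH.measurable
  have hGm : Measurable fun ω i => G i ω := measurable_pi_lambda _ hG.measurable
  -- the terrestrial interference, which is independent of the satellite network
  set J : Ω → ℝ := fun ω => ∑ i : Fin (K ω), p.terrestrialWeight o (y i ω, G i ω) with hJ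
  have hJm : Measurable J := (p.measurable_terrestrialInterference o).comp (hKym.prodMk hGm)
  have hJ0 : ∀ ω, 0 ≤ J ω := fun ω =>
    Finset.sum_nonneg fun i _ => NetworkParams.terrestrialWeight_nonneg hp o (hG.nonneg i ω)
  have hind : IndepFun (fun ω => ((N ω, fun i => x i ω), fun i => H i ω)) J P :=
    (hxHy.prodMk_right_of_prodMk_left (hNxm.prodMk hHm) hKym hGm hxHyG).comp measurable_id
      (p.measurable_terrestrialInterference o)
  have hyG : IndepFun (fun ω => (K ω, fun i => y i ω)) (fun ω i => G i ω) P :=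
    hxHyG.comp measurable_snd measurable_id
  have hS := hx.isPoissonWith hRS hp.lamS_pos hH.measurable hH.indep hHmap hJm hxH hind
  have hT := hy.isPoissonWith (J := fun _ => ()) hRq hlq hG.measurable hG.indep hGmap
    measurable_const hyG (indepFun_const_right _ _)
  have := Measure.isProbabilityMeasure_map (μ := P) (measurable_const (a := ())).aemeasurable
  have hτ : ∀ s, 0 ≤ s → ∫⁻ t, ENNReal.ofReal (exp (-(s * t))) ∂P.map J =
      ENNReal.ofReal (exp (-p.terrestrialExponent o s)) := fun s hs => by
    rw [lintegral_map (by fun_prop) hJm]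
    exact NetworkParams.lintegral_exp_neg_terrestrial hp o hT hs
  have hz : ∀ i ω, 0 ≤ ((fun i ω => (x i ω, H i ω)) i ω : Space3 × ℝ).2 := hH.nonneg
  -- no two satellites are equally far from the user, so that the serving one is unambiguous
  have hne := hS.ae_ne (D := fun ξ => ‖ξ.1 - p.user‖) (by fun_prop) fun r => by
    rw [show {ξ : Space3 × ℝ | ‖ξ.1 - p.user‖ = r} = {x | ‖x - p.user‖ = r} ×ˢ univ by ext; simp,
      Measure.prod_prod]
    rw [show sphereUniform p.RS {x | ‖x - p.user‖ = r} = 0 from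
      sphereUniform_dist_eq hp.RU_pos hp.RU_lt_RS.le r, zero_mul]
  set S : Ω → ℝ := fun ω => p.sinr o (N ω) (fun i => x i ω) (fun i => H i ω)
    (K ω) (fun i => y i ω) (fun i => G i ω) with hSdef
  have hserve : ∀ᵐ ω ∂P, ∀ {M : Type} [AddCommMonoid M] {F : ℝ → M}, F 0 = 0 →
      F (S ω) = p.servingSum F (N ω) (fun i => (x i ω, H i ω), J ω) := by
    filter_upwards [hne] with ω hω M _ F hF
    exact p.comp_sinr_eq_servingSum hF o (N ω) _ _ (K ω) _ _ hω
  have hS0 : ∀ ω, 0 ≤ S ω := fun ω => NetworkParams.sinr_nonneg hp o _ _ (fun i => hH.nonneg i ω) _ _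
    (fun i => hG.nonneg i ω)
  have hSm : AEMeasurable S P := by
    refine ⟨_, hS.measurable_comp (p.measurable_servingSum measurable_id), ?_⟩
    filter_upwards [hserve] with ω hω using hω (F := id) rfl
  have hSint : Integrable S P := by
    refine ⟨hSm.aestronglyMeasurable, (hasFiniteIntegral_iff_ofReal (ae_of_all _ hS0)).2 ?_⟩
    rw [lintegral_congr_ae (by filter_upwards [hserve] with ω hω using hω ENNReal.ofReal_zero)]
    exact NetworkParams.lintegral_servingSum_ofReal_lt_top hp hS hz hJ0
  have htail : ∀ γ, 0 < γ → P {ω | γ < S ω} =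
      ∫⁻ ω, p.servingSum ((Ioi γ).indicator (1 : ℝ → ENNReal)) (N ω)
        (fun i => (x i ω, H i ω), J ω) ∂P := by
    intro γ hγ
    rw [← lintegral_congr_ae (by
      filter_upwards [hserve] with ω hω using
        hω (F := (Ioi γ).indicator (1 : ℝ → ENNReal)) (by simp [hγ.le]))]
    rw [← lintegral_indicator_one₀ (nullMeasurableSet_lt aemeasurable_const hSm)]
    rfl
  have hcov := fun γ (hγ : 0 < γ) => NetworkParams.lintegral_servingSum_indicator hp hS hτ hz hJ0 hγ
    (by rw [← htail γ hγ]; exact measure_lt_top _ _)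
  obtain ⟨h1, h2, h3⟩ := integral_logb_one_add hS0 hSint fun γ hγ =>
    ⟨(hcov γ hγ).2.1, (htail γ hγ).trans (hcov γ hγ).2.2⟩
  have hrate : ∀ γ, p.visibleProb * (∫ r in (p.Rmin p.RS)..(p.Rmax p.RS),
      p.coverage o γ r * p.nearestPDF r) * (logb 2 (exp 1) / (1 + γ)) =
      p.visibleProb * ∫ r in (p.Rmin p.RS)..(p.Rmax p.RS), p.rateIntegrand o γ r := by
    intro γ
    simp only [NetworkParams.rateIntegrand]
    rw [intervalIntegral.integral_mul_const, mul_assoc]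
  simp_rw [hrate] at h2 h3
  refine ⟨h1, fun γ hγ => (hcov γ hγ).1.mul_const _, ?_, ?_⟩
  · have := h2.const_mul (p.visibleProb⁻¹)
    simp only [inv_mul_cancel_left₀ (NetworkParams.visibleProb_pos hp).ne'] at this
    exact this
  · rw [h3, integral_const_mul]
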